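/- Let $d\in\mathbb N$, $d \ge 1$. For $m\in C_0^\infty(\mathbb R^d)$ and a tempered distribution $f\in\mathcal S'(\mathbb R^d)$, $\mathcal F^{-1}[m\,\mathcal F f]$ is a function; write $\|\cdot|L_p\|$ for its $L_p(\mathbb R^d)$-quasi-norm. Fix a non-negative $\phi_0\in C_0^\infty(\mathbb R^d)$ with $\phi_0(x)=1$ for $|x|\le 1$ and $\phi_0(x)=0$ for $|x|\ge 3/2$, and $\varphi_0\in C_0^\infty(\mathbb R)$ with $\varphi_0=1$ on $[-1,1]$ and $\operatorname{supp}\varphi_0\subset[-\tfrac32,\tfrac32]$. For $j\ge1$ put $\phi_j(x)=\phi_0(2^{-j}x)-\phi_0(2^{-j+1}x)$, likewise $\varphi_j$ from $\varphi_0$, and for $\bar k\in\mathbb N_0^d$ put $\varphi_{\bar k}(x)=\varphi_{k_1}(x_1)\cdots\varphi_{k_d}(x_d)$, $|\bar k|=k_1+\dots+k_d$. For $t\in\mathbb R$ and $0<p,q\le\infty$ let $B^t_{p,q}(\mathbb R^d)$ and $S^t_{p,q}B(\mathbb R^d)$ be the spaces of all $f\in\mathcal S'(\mathbb R^d)$ for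 which $$\|f|B^t_{p,q}\|=\Big(\sum_{j=0}^\infty 2^{jtq}\|\mathcal F^{-1}[\phi_j\mathcal F f]|L_p\|^q\Big)^{1/q},\qquad \|f|S^t_{p,q}B\|=\Big(\sum_{\bar k\in\mathbb N_0^d}2^{|\bar k|tq}\|\mathcal F^{-1}[\varphi_{\bar k}\mathcal F f]|L_p\|^q\Big)^{1/q},$$ respectively, is finite (supremum if $q=\infty$). The symbol $X\hookrightarrow Y$ means that $X\subset Y$ with continuous inclusion, i.e. $\|f|Y\|\le C\,\|f|X\|$ for all $f\in X$, with a constant $C$ independent of $f$. **Theorem 3.4.** Let $t\in\mathbb R$ and $0<p,q\le\infty$ be fixed. Then for all $t_0\in\mathbb R$ and $0<p_0,q_0\le\infty$, $$S^{t_0}_{p_0,q_0}B(\mathbb R^d)\hookrightarrow B^t_{p,q}(\mathbb R^d)\quad\Longrightarrow\quad S^{t_0}_{p_0,q_0}B(\mathbb R^d)\hookrightarrow S^t_{p,q}B(\mathbb R^d).$$ In particular, whenever $S^t_{p,q}B(\mathbb R^d)\hookrightarrow B^t_{p,q}(\mathbb R^d)$ holds, $S^t_{p,q}B(\mathbb R^d)$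 is the largest among all spaces $S^{t_0}_{p_0,q_0}B(\mathbb R^d)$ that embed continuously into $B^t_{p,q}(\mathbb R^d)$: it is one of them, and each of them embeds continuously into it. -/

import Mathlib

open scoped ENNReal NNReal SchwartzMap

/-- A generator of an isotropic smooth dyadic decomposition of unity on `ℝ^d`: a non-negative
function `φ₀ ∈ C₀^∞(ℝ^d)` with `φ₀(x) = 1` for `|x| ≤ 1` and `φ₀(x) = 0` for `|x| ≥ 3/2`
(Euclidean norm). -/
structure IsoGenerator (d : ℕ) where
  toFun : EuclideanSpace ℝ (Fin d) → ℝ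
  smooth : ContDiff ℝ (⊤ : ℕ∞) toFun
  nonneg : ∀ x, 0 ≤ toFun x
  eq_one : ∀ x, ‖x‖ ≤ 1 → toFun x = 1
  eq_zero : ∀ x, 3 / 2 ≤ ‖x‖ → toFun x = 0

/-- A generator of a smooth dyadic decomposition of unity on `ℝ`: a complex-valued function
`φ₀ ∈ C₀^∞(ℝ)` with `φ₀ = 1` on `[-1, 1]` and `supp φ₀ ⊆ [-3/2, 3/2]`. -/
structure LineGenerator where
  toFun : ℝ → ℂ
  smooth : ContDiff ℝ (⊤ : ℕ∞) toFun
  eq_one : ∀ x ∈ Set.Icc (-1 : ℝ) 1, toFun x = 1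
  tsupport_subset : tsupport toFun ⊆ Set.Icc (-(3 / 2) : ℝ) (3 / 2)

noncomputable section

/-- The functions `φ₀` and `φ_j(x) = φ₀(2^{-j} x) - φ₀(2^{-j+1} x)`, `j ≥ 1`, on `ℝ^d`. -/
def IsoGenerator.dyadic {d : ℕ} (φ : IsoGenerator d) (j : ℕ) (x : EuclideanSpace ℝ (Fin d)) : ℂ :=
  if j = 0 then (φ.toFun x : ℂ)
  else ((φ.toFun (((2 : ℝ) ^ (-(j : ℤ))) • x) - φ.toFun (((2 : ℝ) ^ (-(j : ℤ) + 1)) • x) : ℝ) : ℂ)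

/-- The functions `φ₀` and `φ_j(x) = φ₀(2^{-j} x) - φ₀(2^{-j+1} x)`, `j ≥ 1`, on `ℝ`. -/
def LineGenerator.dyadic (φ : LineGenerator) (j : ℕ) (x : ℝ) : ℂ :=
  if j = 0 then φ.toFun x
  else φ.toFun ((2 : ℝ) ^ (-(j : ℤ)) * x) - φ.toFun ((2 : ℝ) ^ (-(j : ℤ) + 1) * x)

/-- The tensor product `φ_k(x) = φ_{k_1}(x_1) ⋯ φ_{k_d}(x_d)` for `k ∈ ℕ₀^d`. -/
def LineGenerator.tensor {d : ℕ} (φ : LineGenerator) (k : Fin d → ℕ)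
    (x : EuclideanSpace ℝ (Fin d)) : ℂ :=
  ∏ i, φ.dyadic (k i) (x i)

/-- The distribution `F⁻¹[m F f]` for `f ∈ S'(ℝ^d)`, where
`F g (ξ) = (2π)^{-d/2} ∫ e^{i x ξ} g(x) dx`. Mathlib's Fourier transform is
`g ↦ ∫ e^{-2πi x η} g(x) dx`, so `F` is Mathlib's transform read at `η = -ξ / (2π)`, times a
constant; the symbol `m(ξ)` therefore becomes `m(-2π η)`. -/
def fourierBlock {d : ℕ} (m : EuclideanSpace ℝ (Fin d) → ℂ)
    (f : 𝓢'(EuclideanSpace ℝ (Fin d), ℂ)) : 𝓢'(EuclideanSpace ℝ (Fin d), ℂ) :=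
  TemperedDistribution.fourierMultiplierCLM ℂ (fun η => m ((-(2 * Real.pi)) • η)) f

/-- The tempered distribution `T` is given by the (a.e. unique) function `g`. -/
def RepresentedBy {d : ℕ} (T : 𝓢'(EuclideanSpace ℝ (Fin d), ℂ))
    (g : EuclideanSpace ℝ (Fin d) → ℂ) : Prop :=
  MeasureTheory.AEStronglyMeasurable g MeasureTheory.volume ∧
    ∀ u : 𝓢(EuclideanSpace ℝ (Fin d), ℂ),
      MeasureTheory.Integrable (fun x => u x * g x) MeasureTheory.volume ∧ T u = ∫ x, u x * g x

/-- `‖T | L_p(ℝ^d)‖` for a tempered distribution `T` and `0 < p ≤ ∞`: the `L_p`-(quasi-)norm of the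
function representing `T`. It is `∞` if `T` is not a function. As the representing function is
unique up to null sets, the infimum is over a single value. -/
def lpNormDist {d : ℕ} (p : ℝ≥0∞) (T : 𝓢'(EuclideanSpace ℝ (Fin d), ℂ)) : ℝ≥0∞ :=
  ⨅ (g : EuclideanSpace ℝ (Fin d) → ℂ) (_ : RepresentedBy T g),
    MeasureTheory.eLpNorm g p MeasureTheory.volume

/-- The `ℓ_q`-(quasi-)norm of a family of extended non-negative numbers, `0 < q ≤ ∞`. -/
def lqNorm {ι : Type*} (q : ℝ≥0∞) (a : ι → ℝ≥0∞) : ℝ≥0∞ :=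
  if q = (⊤ : ℝ≥0∞) then ⨆ i, a i else (∑' i, a i ^ q.toReal) ^ (1 / q.toReal)

/-- The quasi-norm of the isotropic Besov space `B^t_{p,q}(ℝ^d)` (value `∞` outside the space). -/
def isoBesovNorm {d : ℕ} (φ : IsoGenerator d) (t : ℝ) (p q : ℝ≥0∞)
    (f : 𝓢'(EuclideanSpace ℝ (Fin d), ℂ)) : ℝ≥0∞ :=
  lqNorm q fun j : ℕ => (2 : ℝ≥0∞) ^ ((j : ℝ) * t) * lpNormDist p (fourierBlock (φ.dyadic j) f)

/-- The quasi-norm of the Besov space of dominating mixed smoothness `S^t_{p,q}B(ℝ^d)`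
(value `∞` outside the space). -/
def mixedBesovNorm {d : ℕ} (φ : LineGenerator) (t : ℝ) (p q : ℝ≥0∞)
    (f : 𝓢'(EuclideanSpace ℝ (Fin d), ℂ)) : ℝ≥0∞ :=
  lqNorm q fun k : Fin d → ℕ =>
    (2 : ℝ≥0∞) ^ (((∑ i, k i : ℕ) : ℝ) * t) * lpNormDist p (fourierBlock (φ.tensor k) f)

/-- The space of all tempered distributions on which an extended quasi-norm is finite. For
`isoBesovNorm` and `mixedBesovNorm` these are `B^t_{p,q}(ℝ^d)` and `S^t_{p,q}B(ℝ^d)`. -/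
def distSpace {d : ℕ} (N : 𝓢'(EuclideanSpace ℝ (Fin d), ℂ) → ℝ≥0∞) :
    Set 𝓢'(EuclideanSpace ℝ (Fin d), ℂ) :=
  {f | N f < (⊤ : ℝ≥0∞)}

/-- Continuous embedding `X ↪ Y` of quasi-normed spaces of tempered distributions, given by their
extended quasi-norms: `X ⊆ Y` and the inclusion is bounded. -/
def ContEmbeds {d : ℕ} (NX NY : 𝓢'(EuclideanSpace ℝ (Fin d), ℂ) → ℝ≥0∞) : Prop :=
  distSpace NX ⊆ distSpace NY ∧ ∃ C : ℝ≥0, ∀ f ∈ distSpace NX, NY f ≤ C * NX f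

/-- The class of all spaces `S^{t₀}_{p₀,q₀}B(ℝ^d)`, `t₀ ∈ ℝ`, `0 < p₀, q₀ ≤ ∞`, each given by its
quasi-norm, that embed continuously into `B^t_{p,q}(ℝ^d)`. -/
def mixedSpacesEmbeddingInto {d : ℕ} (φ : LineGenerator) (ψ : IsoGenerator d)
    (t : ℝ) (p q : ℝ≥0∞) : Set (𝓢'(EuclideanSpace ℝ (Fin d), ℂ) → ℝ≥0∞) :=
  {N | ∃ (t₀ : ℝ) (p₀ q₀ : ℝ≥0∞), 0 < p₀ ∧ 0 < q₀ ∧ N = mixedBesovNorm φ t₀ p₀ q₀ ∧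
    ContEmbeds N (isoBesovNorm ψ t p q)}

end

/-! Both embeddings are governed by the same three conditions: `p₀ ≤ p`, `t - 1/p ≤ t₀ - 1/p₀`, and
`q₀ ≤ q` in case of equality. They are necessary for the embedding of the mixed space into the
isotropic one, and sufficient for the embedding into the mixed space `S^t_{p,q}B`. Throughout, `(1 /
p).toReal` makes `1/∞ = 0`, so `p = ∞` and `q = ∞` need no separate formulas.

Necessity: near a coordinate axis the two decompositions coincide. A function with spectrum close to
`2^j · (7/8) e_{i₀}` meets only the isotropic block `j` and only the mixed block `(0, …, j, …, 0)`,
with the same weight. On sums of such functions both quasi-norms are therefore explicit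
one-parameter `ℓ_q` sums (`isoBesovNorm_sum`, `mixedBesovNorm_sum`). Dilating a fixed function in
one variable gives the condition on smoothness, and adding `2^n` normalized pieces the one on `q`.
Dilating a low-frequency function towards frequency zero gives `p₀ ≤ p`.

Sufficiency: each mixed block has its spectrum in a box of volume comparable to `2^{|k|}`, so
Nikol'skii's inequality (`exists_nikolskii_const`) replaces `L_p` by `L_{p₀}` at the cost of
`2^{|k|(1/p₀ - 1/p)}`. The blocks are then compared by monotonicity of `ℓ_q`, or by a geometric
series when the smoothness inequality is strict (`exists_mixedBesovNorm_le`). -/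

noncomputable section

open MeasureTheory FourierTransform

/-! ### Anisotropic dilations: `L_p`-norms and Fourier transforms -/

/-- The anisotropic dyadic dilation `x ↦ (2^{n_1} x_1, …, 2^{n_d} x_d)`. -/
def dyadicScale {d : ℕ} (n : Fin d → ℤ) :
    EuclideanSpace ℝ (Fin d) ≃L[ℝ] EuclideanSpace ℝ (Fin d) :=
  (EuclideanSpace.equiv (Fin d) ℝ).trans
    ((ContinuousLinearEquiv.piCongrRight fun i =>
      ContinuousLinearEquiv.unitsEquivAut ℝ (Units.mk0 (2 : ℝ) two_ne_zero ^ n i)).trans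
    (EuclideanSpace.equiv (Fin d) ℝ).symm)

@[simp]
theorem dyadicScale_apply {d : ℕ} (n : Fin d → ℤ) (x : EuclideanSpace ℝ (Fin d)) (i : Fin d) :
    dyadicScale n x i = 2 ^ n i * x i := by
  simp [dyadicScale, mul_comm]

theorem dyadicScale_neg_apply {d : ℕ} (n : Fin d → ℤ) (x : EuclideanSpace ℝ (Fin d)) :
    dyadicScale (-n) (dyadicScale n x) = x := by
  ext i
  simp [← mul_assoc, inv_mul_cancel₀ (zpow_ne_zero (n i) (two_ne_zero (α := ℝ)))]

theorem dyadicScale_apply_neg {d : ℕ} (n : Fin d → ℤ) (x : EuclideanSpace ℝ (Fin d)) :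
    dyadicScale n (dyadicScale (-n) x) = x := by
  simpa using dyadicScale_neg_apply (-n) x

theorem inner_dyadicScale {d : ℕ} (n : Fin d → ℤ) (x y : EuclideanSpace ℝ (Fin d)) :
    inner ℝ (dyadicScale n x) y = inner ℝ x (dyadicScale n y) := by
  simp only [PiLp.inner_apply, dyadicScale_apply]
  exact Finset.sum_congr rfl fun i _ => by simp; ring

theorem det_dyadicScale {d : ℕ} (n : Fin d → ℤ) :
    LinearMap.det ((dyadicScale n : EuclideanSpace ℝ (Fin d) ≃ₗ[ℝ] EuclideanSpace ℝ (Fin d)) :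
      EuclideanSpace ℝ (Fin d) →ₗ[ℝ] EuclideanSpace ℝ (Fin d)) = 2 ^ ∑ i, n i := by
  have h : LinearMap.toMatrix (EuclideanSpace.basisFun (Fin d) ℝ).toBasis
      (EuclideanSpace.basisFun (Fin d) ℝ).toBasis
      ((dyadicScale n : EuclideanSpace ℝ (Fin d) ≃ₗ[ℝ] EuclideanSpace ℝ (Fin d)) :
        EuclideanSpace ℝ (Fin d) →ₗ[ℝ] EuclideanSpace ℝ (Fin d)) =
      Matrix.diagonal fun i => (2 : ℝ) ^ n i := by
    ext i j
    rw [LinearMap.toMatrix_apply]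
    by_cases hij : i = j
    · subst hij; simp
    · simp [hij]
  rw [← LinearMap.det_toMatrix (EuclideanSpace.basisFun (Fin d) ℝ).toBasis, h,
    Matrix.det_diagonal]
  simp only [← Real.rpow_intCast, Int.cast_sum]
  exact (Real.rpow_sum_of_pos two_pos _ _).symm

theorem map_dyadicScale {d : ℕ} (n : Fin d → ℤ) :
    Measure.map (dyadicScale n) (volume : Measure (EuclideanSpace ℝ (Fin d))) =
      (2 : ℝ≥0∞) ^ (-((∑ i, n i : ℤ) : ℝ)) • volume := by
  have h := Measure.map_linearMap_addHaar_eq_smul_addHaar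
    (volume : Measure (EuclideanSpace ℝ (Fin d)))
    (f := ((dyadicScale n : EuclideanSpace ℝ (Fin d) ≃ₗ[ℝ] EuclideanSpace ℝ (Fin d)) :
      EuclideanSpace ℝ (Fin d) →ₗ[ℝ] EuclideanSpace ℝ (Fin d)))
    (by rw [det_dyadicScale]; positivity)
  rw [det_dyadicScale] at h
  refine Eq.trans h ?_
  congr 1
  rw [abs_of_pos (by positivity), ← zpow_neg, ← Real.rpow_intCast,
    ← ENNReal.ofReal_rpow_of_pos two_pos]
  simp

theorem eLpNorm_comp_dyadicScale {d : ℕ} (n : Fin d → ℤ) (p : ℝ≥0∞)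
    {g : EuclideanSpace ℝ (Fin d) → ℂ} (hg : AEStronglyMeasurable g volume) :
    eLpNorm (fun x => g (dyadicScale n x)) p volume =
      (2 : ℝ≥0∞) ^ (-((∑ i, n i : ℤ) : ℝ) * (1 / p).toReal) * eLpNorm g p volume := by
  have hm : (2 : ℝ≥0∞) ^ (-((∑ i, n i : ℤ) : ℝ)) ≠ 0 := by simp
  have h := eLpNorm_map_measure (p := p) (μ := (volume : Measure (EuclideanSpace ℝ (Fin d))))
    (f := dyadicScale n) (g := g)
    (by rw [map_dyadicScale]; exact hg.mono_ac Measure.smul_absolutelyContinuous)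
    (dyadicScale n).continuous.aemeasurable
  rw [map_dyadicScale, eLpNorm_smul_measure_of_ne_zero hm] at h
  rw [ENNReal.rpow_mul, ← smul_eq_mul, h]
  rfl

theorem lintegral_comp_dyadicScale {d : ℕ} (n : Fin d → ℤ)
    {g : EuclideanSpace ℝ (Fin d) → ℝ≥0∞} (hg : Measurable g) :
    ∫⁻ x, g (dyadicScale n x) = (2 : ℝ≥0∞) ^ (-((∑ i, n i : ℤ) : ℝ)) * ∫⁻ x, g x := by
  rw [← lintegral_map hg (dyadicScale n).continuous.measurable, map_dyadicScale,
    lintegral_smul_measure, smul_eq_mul]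

theorem integral_comp_dyadicScale {d : ℕ} (n : Fin d → ℤ) (g : EuclideanSpace ℝ (Fin d) → ℂ) :
    ∫ x, g (dyadicScale n x) = (2 : ℝ) ^ (-∑ i, n i) • ∫ x, g x := by
  refine ((dyadicScale n).toHomeomorph.measurableEmbedding.integral_map (μ := volume) g).symm.trans ?_
  have : Measure.map (dyadicScale n).toHomeomorph
      (volume : Measure (EuclideanSpace ℝ (Fin d))) = _ := map_dyadicScale n
  rw [this, integral_smul_measure, ← ENNReal.toReal_rpow]
  simp only [ENNReal.toReal_ofNat]
  rw [← Real.rpow_intCast]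
  push_cast
  rfl

/-- Composition of a Schwartz function with an anisotropic dyadic dilation. -/
def schwartzScale {d : ℕ} (n : Fin d → ℤ) (F : 𝓢(EuclideanSpace ℝ (Fin d), ℂ)) :
    𝓢(EuclideanSpace ℝ (Fin d), ℂ) :=
  SchwartzMap.compCLMOfContinuousLinearEquiv ℂ (dyadicScale n) F

theorem schwartzScale_apply {d : ℕ} (n : Fin d → ℤ) (F : 𝓢(EuclideanSpace ℝ (Fin d), ℂ))
    (x : EuclideanSpace ℝ (Fin d)) : schwartzScale n F x = F (dyadicScale n x) := rfl

theorem fourier_schwartzScale {d : ℕ} (n : Fin d → ℤ) (F : 𝓢(EuclideanSpace ℝ (Fin d), ℂ))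
    (ξ : EuclideanSpace ℝ (Fin d)) :
    𝓕 (schwartzScale n F) ξ = (2 : ℝ) ^ (-∑ i, n i) • 𝓕 F (dyadicScale (-n) ξ) := by
  rw [SchwartzMap.fourier_coe, SchwartzMap.fourier_coe, Real.fourier_eq, Real.fourier_eq,
    ← integral_comp_dyadicScale]
  refine integral_congr_ae (Filter.Eventually.of_forall fun x => ?_)
  simp only [schwartzScale_apply]
  rw [inner_dyadicScale, dyadicScale_apply_neg]

/-! ### Distributions represented by functions -/

theorem exists_schwartz_eq_ofReal {E : Type*} [NormedAddCommGroup E] [NormedSpace ℝ E]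
    {b : E → ℝ} (hc : HasCompactSupport b) (hb : ContDiff ℝ (⊤ : ℕ∞) b) :
    ∃ u : 𝓢(E, ℂ), ∀ x, u x = b x := by
  have hc' : HasCompactSupport (Complex.ofRealCLM ∘ b) := hc.comp_left (map_zero _)
  have hs : ContDiff ℝ (⊤ : ℕ∞) (Complex.ofRealCLM ∘ b) := Complex.ofRealCLM.contDiff.comp hb
  exact ⟨hc'.toSchwartzMap hs, fun x => rfl⟩

theorem locallyIntegrable_of_integrable_mul_schwartz {d : ℕ} {g : EuclideanSpace ℝ (Fin d) → ℂ}
    (hg : ∀ u : 𝓢(EuclideanSpace ℝ (Fin d), ℂ), Integrable (fun x => u x * g x) volume) :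
    LocallyIntegrable g volume := by
  intro x
  let b : ContDiffBump x := ⟨1, 2, one_pos, one_lt_two⟩
  obtain ⟨u, hu⟩ := exists_schwartz_eq_ofReal b.hasCompactSupport b.contDiff
  refine ⟨Metric.closedBall x 1, Metric.closedBall_mem_nhds x one_pos, ?_⟩
  refine (hg u).integrableOn.congr_fun (fun y hy => ?_) Metric.isClosed_closedBall.measurableSet
  simp only [hu, b.one_of_mem_closedBall hy, Complex.ofReal_one, one_mul]

theorem ae_eq_of_integral_mul_schwartz_eq {d : ℕ} {f g : EuclideanSpace ℝ (Fin d) → ℂ}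
    (hf : LocallyIntegrable f volume) (hg : LocallyIntegrable g volume)
    (h : ∀ u : 𝓢(EuclideanSpace ℝ (Fin d), ℂ), ∫ x, u x * f x = ∫ x, u x * g x) :
    f =ᵐ[volume] g := by
  refine ae_eq_of_integral_contDiff_smul_eq hf hg fun b hb hc => ?_
  obtain ⟨u, hu⟩ := exists_schwartz_eq_ofReal hc hb
  simpa only [hu, Complex.real_smul] using h u

/-- Smooth bumps are test functions, so both representatives are locally integrable and the
fundamental lemma of the calculus of variations applies. This is what collapses the infimum in
`lpNormDist` to a single value. -/
theorem RepresentedBy.ae_eq {d : ℕ} {T : 𝓢'(EuclideanSpace ℝ (Fin d), ℂ)}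
    {f g : EuclideanSpace ℝ (Fin d) → ℂ} (hf : RepresentedBy T f) (hg : RepresentedBy T g) :
    f =ᵐ[volume] g :=
  ae_eq_of_integral_mul_schwartz_eq
    (locallyIntegrable_of_integrable_mul_schwartz fun u => (hf.2 u).1)
    (locallyIntegrable_of_integrable_mul_schwartz fun u => (hg.2 u).1)
    fun u => (hf.2 u).2.symm.trans (hg.2 u).2

theorem RepresentedBy.lpNormDist_eq {d : ℕ} {T : 𝓢'(EuclideanSpace ℝ (Fin d), ℂ)}
    {g : EuclideanSpace ℝ (Fin d) → ℂ} (hg : RepresentedBy T g) (p : ℝ≥0∞) :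
    lpNormDist p T = eLpNorm g p volume :=
  le_antisymm (iInf₂_le g hg) (le_iInf₂ fun _ hf => (eLpNorm_congr_ae (hg.ae_eq hf)).le)

theorem representedBy_schwartz {d : ℕ} (F : 𝓢(EuclideanSpace ℝ (Fin d), ℂ)) :
    RepresentedBy (F : 𝓢'(EuclideanSpace ℝ (Fin d), ℂ)) F := by
  refine ⟨F.continuous.aestronglyMeasurable, fun u => ⟨?_, ?_⟩⟩
  · exact F.integrable.bdd_mul u.continuous.aestronglyMeasurable
      (Filter.Eventually.of_forall fun x => SchwartzMap.norm_le_seminorm ℝ u x)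
  · simp

theorem lpNormDist_schwartz {d : ℕ} (p : ℝ≥0∞) (F : 𝓢(EuclideanSpace ℝ (Fin d), ℂ)) :
    lpNormDist p (F : 𝓢'(EuclideanSpace ℝ (Fin d), ℂ)) = eLpNorm F p volume :=
  (representedBy_schwartz F).lpNormDist_eq p

/-! ### Fourier multipliers -/

theorem LineGenerator.hasTemperateGrowth (φ : LineGenerator) :
    φ.toFun.HasTemperateGrowth :=
  HasCompactSupport.hasTemperateGrowth
    (isCompact_Icc.of_isClosed_subset (isClosed_tsupport _) φ.tsupport_subset) φ.smooth

theorem LineGenerator.dyadic_hasTemperateGrowth (φ : LineGenerator) (j : ℕ) :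
    (φ.dyadic j).HasTemperateGrowth := by
  have h (c : ℝ) : (fun x : ℝ => φ.toFun (c * x)).HasTemperateGrowth :=
    φ.hasTemperateGrowth.comp (c • ContinuousLinearMap.id ℝ ℝ).hasTemperateGrowth
  by_cases hj : j = 0
  · have : φ.dyadic j = φ.toFun := funext fun x => if_pos hj
    exact this ▸ φ.hasTemperateGrowth
  · have : φ.dyadic j = fun x => φ.toFun ((2 : ℝ) ^ (-(j : ℤ)) * x) -
        φ.toFun ((2 : ℝ) ^ (-(j : ℤ) + 1) * x) := funext fun x => if_neg hj
    exact this ▸ (h _).sub (h _)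

theorem Function.HasTemperateGrowth.finset_prod {ι E : Type*} [NormedAddCommGroup E]
    [NormedSpace ℝ E] {s : Finset ι} {f : ι → E → ℂ} (h : ∀ i ∈ s, (f i).HasTemperateGrowth) :
    (fun x => ∏ i ∈ s, f i x).HasTemperateGrowth := by
  classical
  induction s using Finset.induction_on with
  | empty => simp
  | insert a s ha ih =>
    simp only [Finset.prod_insert ha]
    exact (h a (Finset.mem_insert_self a s)).mul
      (ih fun i hi => h i (Finset.mem_insert_of_mem hi))

theorem LineGenerator.tensor_hasTemperateGrowth {d : ℕ} (φ : LineGenerator) (k : Fin d → ℕ) :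
    (φ.tensor k : EuclideanSpace ℝ (Fin d) → ℂ).HasTemperateGrowth :=
  Function.HasTemperateGrowth.finset_prod fun i _ =>
    (φ.dyadic_hasTemperateGrowth (k i)).comp
      (EuclideanSpace.proj i : EuclideanSpace ℝ (Fin d) →L[ℝ] ℝ).hasTemperateGrowth

theorem IsoGenerator.hasTemperateGrowth {d : ℕ} (φ : IsoGenerator d) :
    φ.toFun.HasTemperateGrowth :=
  HasCompactSupport.hasTemperateGrowth
    (HasCompactSupport.intro (isCompact_closedBall 0 (3 / 2)) fun x hx =>
      φ.eq_zero x (by simpa using (not_le.mp (mt mem_closedBall_zero_iff.mpr hx)).le)) φ.smooth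

theorem IsoGenerator.dyadic_hasTemperateGrowth {d : ℕ} (φ : IsoGenerator d) (j : ℕ) :
    (φ.dyadic j).HasTemperateGrowth := by
  have h (c : ℝ) : (fun x => (φ.toFun (c • x) : ℂ)).HasTemperateGrowth :=
    Function.HasTemperateGrowth.comp Function.Complex.hasTemperateGrowth_ofReal (φ.hasTemperateGrowth.comp
      (c • ContinuousLinearMap.id ℝ (EuclideanSpace ℝ (Fin d))).hasTemperateGrowth)
  by_cases hj : j = 0
  · have : φ.dyadic j = fun x => (φ.toFun ((1 : ℝ) • x) : ℂ) :=
      funext fun x => by simp [IsoGenerator.dyadic, hj]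
    exact this ▸ h 1
  · have : φ.dyadic j = fun x => (φ.toFun ((2 : ℝ) ^ (-(j : ℤ)) • x) : ℂ) -
        φ.toFun ((2 : ℝ) ^ (-(j : ℤ) + 1) • x) :=
      funext fun x => by simp [IsoGenerator.dyadic, hj]
    exact this ▸ (h _).sub (h _)

theorem hasTemperateGrowth_comp_smul {d : ℕ} {m : EuclideanSpace ℝ (Fin d) → ℂ}
    (hm : m.HasTemperateGrowth) (c : ℝ) : (fun η => m (c • η)).HasTemperateGrowth :=
  hm.comp (c • ContinuousLinearMap.id ℝ (EuclideanSpace ℝ (Fin d))).hasTemperateGrowth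

/-- Only the values of the symbol on the spectrum of `F` matter. A symbol constant there acts as a
scalar, so the blocks of spectrally localized test functions need no computation of convolutions. -/
theorem fourierBlock_schwartz {d : ℕ} {m : EuclideanSpace ℝ (Fin d) → ℂ}
    (hm : m.HasTemperateGrowth) (c : ℂ) (F : 𝓢(EuclideanSpace ℝ (Fin d), ℂ))
    (h : ∀ η, 𝓕 F η ≠ 0 → m ((-(2 * Real.pi)) • η) = c) :
    fourierBlock m (F : 𝓢'(EuclideanSpace ℝ (Fin d), ℂ)) =
      ((c • F : 𝓢(EuclideanSpace ℝ (Fin d), ℂ)) : 𝓢'(EuclideanSpace ℝ (Fin d), ℂ)) := by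
  have hm' := hasTemperateGrowth_comp_smul hm (-(2 * Real.pi))
  rw [fourierBlock, TemperedDistribution.fourierMultiplierCLM_toTemperedDistributionCLM_eq hm',
    SchwartzMap.fourierMultiplierCLM_apply]
  have : SchwartzMap.smulLeftCLM ℂ (fun η => m ((-(2 * Real.pi)) • η)) (𝓕 F) = c • 𝓕 F := by
    ext η
    rw [SchwartzMap.smulLeftCLM_apply_apply hm', smul_apply]
    by_cases hη : 𝓕 F η = 0
    · simp [hη]
    · rw [h η hη]
  rw [this, FourierTransform.fourierInv_smul, FourierTransform.fourierInv_fourier_eq]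

/-! ### The `ℓ_q`-quasi-norm -/

theorem lqNorm_mono {ι : Type*} (q : ℝ≥0∞) {a b : ι → ℝ≥0∞} (h : ∀ i, a i ≤ b i) :
    lqNorm q a ≤ lqNorm q b := by
  unfold lqNorm
  split_ifs
  · exact iSup_mono h
  · gcongr with i
    exact h i

theorem lqNorm_const_mul {ι : Type*} {q : ℝ≥0∞} (hq : 0 < q) (c : ℝ≥0∞) (a : ι → ℝ≥0∞) :
    lqNorm q (fun i => c * a i) = c * lqNorm q a := by
  unfold lqNorm
  split_ifs with h
  · exact (ENNReal.mul_iSup ..).symm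
  · have hq' : 0 < q.toReal := ENNReal.toReal_pos hq.ne' h
    simp_rw [ENNReal.mul_rpow_of_nonneg _ _ hq'.le, ENNReal.tsum_mul_left]
    rw [ENNReal.mul_rpow_of_nonneg _ _ (by positivity), ← ENNReal.rpow_mul,
      mul_one_div_cancel hq'.ne', ENNReal.rpow_one]

theorem le_lqNorm {ι : Type*} {q : ℝ≥0∞} (hq : 0 < q) (a : ι → ℝ≥0∞) (i : ι) :
    a i ≤ lqNorm q a := by
  unfold lqNorm
  split_ifs with h
  · exact le_iSup a i
  · have hq' : 0 < q.toReal := ENNReal.toReal_pos hq.ne' h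
    rw [one_div, ENNReal.le_rpow_inv_iff hq']
    exact ENNReal.le_tsum i

/-- With `N = lqNorm q₀ a`, each term satisfies `a i ≤ N`, hence `a i ^ q ≤ N ^ (q - q₀) * a i ^
q₀`; sum over `i`. -/
theorem lqNorm_anti {ι : Type*} {q₀ q : ℝ≥0∞} (hq₀ : 0 < q₀) (h : q₀ ≤ q) (a : ι → ℝ≥0∞) :
    lqNorm q a ≤ lqNorm q₀ a := by
  by_cases hq : q = ⊤
  · conv_lhs => rw [lqNorm, if_pos hq]
    exact iSup_le (le_lqNorm hq₀ a)
  · have hq₀' : q₀ ≠ ⊤ := ne_top_of_le_ne_top hq h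
    have h0 : 0 < q₀.toReal := ENNReal.toReal_pos hq₀.ne' hq₀'
    have h1 : q₀.toReal ≤ q.toReal := ENNReal.toReal_mono hq h
    conv_lhs => rw [lqNorm, if_neg hq]
    rw [one_div, ENNReal.rpow_inv_le_iff (h0.trans_le h1)]
    calc ∑' i, a i ^ q.toReal
        = ∑' i, a i ^ (q.toReal - q₀.toReal) * a i ^ q₀.toReal := by
          refine tsum_congr fun i => ?_
          rw [← ENNReal.rpow_add_of_nonneg _ _ (sub_nonneg.2 h1) h0.le, sub_add_cancel]
      _ ≤ ∑' i, lqNorm q₀ a ^ (q.toReal - q₀.toReal) * a i ^ q₀.toReal := by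
          gcongr with i
          exact le_lqNorm hq₀ a i
      _ = lqNorm q₀ a ^ (q.toReal - q₀.toReal) * lqNorm q₀ a ^ q₀.toReal := by
          rw [ENNReal.tsum_mul_left]
          congr 1
          rw [lqNorm, if_neg hq₀', ← ENNReal.rpow_mul, one_div_mul_cancel h0.ne',
            ENNReal.rpow_one]
      _ = lqNorm q₀ a ^ q.toReal := by
          rw [← ENNReal.rpow_add_of_nonneg _ _ (sub_nonneg.2 h1) h0.le, sub_add_cancel]

theorem lqNorm_indicator {ι : Type*} [DecidableEq ι] {q : ℝ≥0∞} (hq : 0 < q) {s : Finset ι}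
    (hs : s.Nonempty) (c : ℝ≥0∞) :
    lqNorm q (fun i => if i ∈ s then c else 0) = (s.card : ℝ≥0∞) ^ (1 / q).toReal * c := by
  unfold lqNorm
  split_ifs with h
  · obtain ⟨i, hi⟩ := hs
    subst h
    simp only [ENNReal.div_top, ENNReal.toReal_zero, ENNReal.rpow_zero, one_mul]
    refine le_antisymm (iSup_le fun j => ?_) (le_iSup_of_le i (by simp [hi]))
    split_ifs <;> simp
  · have hq' : 0 < q.toReal := ENNReal.toReal_pos hq.ne' h
    rw [tsum_eq_sum (s := s) fun i hi => by simp [hi, hq'],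
      Finset.sum_congr rfl (g := fun _ => c ^ q.toReal) fun i hi => by simp [hi],
      Finset.sum_const, nsmul_eq_mul,
      ENNReal.mul_rpow_of_nonneg _ _ (by positivity), ← ENNReal.rpow_mul,
      mul_one_div_cancel hq'.ne', ENNReal.rpow_one]
    simp

/-- The sum is a product of `d` geometric series, split off one coordinate at a time. -/
theorem tsum_pow_sum_lt_top {r : ℝ≥0∞} (hr : r < 1) (d : ℕ) :
    ∑' k : Fin d → ℕ, r ^ ∑ i, k i < ⊤ := by
  induction d with
  | zero => simp
  | succ d ih =>
    rw [← (Fin.consEquiv fun _ : Fin (d + 1) => ℕ).tsum_eq]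
    have : ∀ x : ℕ × (Fin d → ℕ), r ^ ∑ i, (Fin.consEquiv fun _ : Fin (d + 1) => ℕ) x i =
        r ^ x.1 * r ^ ∑ i, x.2 i := fun x => by
      rw [← pow_add, Fin.sum_univ_succ]
      simp [Fin.consEquiv]
    simp_rw [this]
    rw [ENNReal.tsum_prod (f := fun (a : ℕ) (b : Fin d → ℕ) => r ^ a * r ^ ∑ i, b i)]
    simp_rw [ENNReal.tsum_mul_left, ENNReal.tsum_mul_right]
    refine ENNReal.mul_lt_top ?_ ih
    rw [ENNReal.tsum_geometric]
    simpa using hr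

theorem lqNorm_two_rpow_neg_lt_top {d : ℕ} {q : ℝ≥0∞} (hq : 0 < q) {δ : ℝ} (hδ : 0 < δ) :
    lqNorm q (fun k : Fin d → ℕ => (2 : ℝ≥0∞) ^ (((∑ i, k i : ℕ) : ℝ) * -δ)) < ⊤ := by
  unfold lqNorm
  split_ifs with h
  · refine (iSup_le fun k => ?_).trans_lt ENNReal.one_lt_top
    have h0 : (0 : ℝ) ≤ ((∑ i, k i : ℕ) : ℝ) * δ := by positivity
    calc (2 : ℝ≥0∞) ^ (((∑ i, k i : ℕ) : ℝ) * -δ) ≤ 2 ^ (0 : ℝ) :=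
          ENNReal.rpow_le_rpow_of_exponent_le one_le_two (by linarith)
      _ = 1 := ENNReal.rpow_zero
  · have hq' : 0 < q.toReal := ENNReal.toReal_pos hq.ne' h
    refine ENNReal.rpow_lt_top_of_nonneg (by positivity) (ne_of_lt ?_)
    refine lt_of_eq_of_lt (tsum_congr fun k => ?_)
      (tsum_pow_sum_lt_top (r := (2 : ℝ≥0∞) ^ (-δ * q.toReal)) ?_ d)
    · rw [← ENNReal.rpow_mul, ← ENNReal.rpow_natCast, ← ENNReal.rpow_mul]
      ring_nf
    · exact ENNReal.rpow_lt_one_of_one_lt_of_neg ENNReal.one_lt_two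
        (mul_neg_of_neg_of_pos (neg_lt_zero.2 hδ) hq')

/-! ### Nikol'skii's inequality -/

/-- If a bounded kernel reproduces an integrable function up to absolute values, then the function
is bounded by its `L_p`-quasi-norm, for every `0 < p ≤ ∞`. -/
theorem eLpNorm_top_le_of_le_lintegral_kernel {E : Type*} [NormedAddCommGroup E]
    [MeasurableSpace E] [BorelSpace E] {μ : Measure E} [μ.IsAddLeftInvariant] [μ.IsNegInvariant]
    {K h : E → ℂ} {κ L : ℝ≥0∞} {p : ℝ≥0∞} (hp : 0 < p) (hK : Continuous K)
    (hκ : ∀ x, ‖K x‖ₑ ≤ κ) (hκ' : κ ≠ ⊤) (hL : ∫⁻ x, ‖K x‖ₑ ∂μ ≤ L) (hL1 : 1 ≤ L)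
    (hh : Integrable h μ)
    (hrep : ∀ᵐ y ∂μ, ‖h y‖ₑ ≤ ∫⁻ x, ‖h x‖ₑ * ‖K (x - y)‖ₑ ∂μ) :
    eLpNorm h ⊤ μ ≤ L * κ ^ (1 / p).toReal * eLpNorm h p μ := by
  by_cases hpt : p = ⊤
  · subst hpt
    simpa using mul_le_mul' hL1 (le_refl (eLpNorm h ⊤ μ))
  have hp' : 0 < p.toReal := ENNReal.toReal_pos hp.ne' hpt
  have htr : (1 / p).toReal = 1 / p.toReal := by simp
  have hI := eLpNorm_eq_lintegral_rpow_enorm_toReal (μ := μ) (f := h) hp.ne' hpt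
  have hhm : AEMeasurable (fun x => ‖h x‖ₑ) μ := hh.aestronglyMeasurable.enorm
  rw [htr]
  rcases le_or_gt p 1 with h1 | h1
  · have h1' : p.toReal ≤ 1 := by simpa using ENNReal.toReal_mono ENNReal.one_ne_top h1
    set M := eLpNorm h ⊤ μ with hM
    have hbd : ∀ᵐ x ∂μ, ‖h x‖ₑ ≤ M := by
      rw [hM, eLpNorm_exponent_top]
      exact enorm_ae_le_eLpNormEssSup h μ
    -- For `p ≤ 1`: `M ≤ κ ∫ |h| ≤ κ M^{1-p} ∫ |h|^p`, and one divides by `M^{1-p}`. The division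
    -- needs `M` finite, which integrability of `h` supplies.
    have hstep : M ≤ κ * ∫⁻ x, ‖h x‖ₑ ∂μ := by
      rw [hM, eLpNorm_exponent_top]
      refine essSup_le_of_ae_le _ ?_
      filter_upwards [hrep] with y hy
      refine hy.trans ?_
      rw [← lintegral_const_mul'' _ hhm]
      refine lintegral_mono fun x => ?_
      rw [mul_comm]
      gcongr
      exact hκ _
    have hMtop : M ≠ ⊤ :=
      (hstep.trans_lt (ENNReal.mul_lt_top hκ'.lt_top hh.hasFiniteIntegral)).ne
    by_cases hM0 : M = 0
    · simp [hM0]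
    have hsplit : ∫⁻ x, ‖h x‖ₑ ∂μ ≤ M ^ (1 - p.toReal) * ∫⁻ x, ‖h x‖ₑ ^ p.toReal ∂μ := by
      rw [← lintegral_const_mul'' _ (hhm.pow_const _)]
      refine lintegral_mono_ae ?_
      filter_upwards [hbd] with x hx
      calc ‖h x‖ₑ = ‖h x‖ₑ ^ (1 - p.toReal) * ‖h x‖ₑ ^ p.toReal := by
            rw [← ENNReal.rpow_add_of_nonneg _ _ (sub_nonneg.2 h1') hp'.le, sub_add_cancel,
              ENNReal.rpow_one]
        _ ≤ _ := by
            gcongr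
    have hpow : M ^ p.toReal ≤ κ * ∫⁻ x, ‖h x‖ₑ ^ p.toReal ∂μ := by
      have hne : M ^ (1 - p.toReal) ≠ 0 := by simp [hM0, hMtop]
      have hnt : M ^ (1 - p.toReal) ≠ ⊤ := by simp [hM0, hMtop]
      refine (ENNReal.mul_le_mul_iff_right hne hnt).1 ?_
      rw [← ENNReal.rpow_add_of_nonneg _ _ (sub_nonneg.2 h1') hp'.le, sub_add_cancel,
        ENNReal.rpow_one]
      calc M ≤ κ * ∫⁻ x, ‖h x‖ₑ ∂μ := hstep
        _ ≤ κ * (M ^ (1 - p.toReal) * ∫⁻ x, ‖h x‖ₑ ^ p.toReal ∂μ) := by gcongr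
        _ = _ := by ring
    have : M ≤ (κ * ∫⁻ x, ‖h x‖ₑ ^ p.toReal ∂μ) ^ (1 / p.toReal) := by
      rw [one_div, ENNReal.le_rpow_inv_iff hp']
      exact hpow
    rw [ENNReal.mul_rpow_of_nonneg _ _ (by positivity), ← hI] at this
    calc M ≤ 1 * (κ ^ (1 / p.toReal) * eLpNorm h p μ) := by rwa [one_mul]
      _ ≤ L * (κ ^ (1 / p.toReal) * eLpNorm h p μ) := by gcongr
      _ = _ := by ring
  · have h1' : 1 < p.toReal := by
      simpa using (ENNReal.toReal_lt_toReal ENNReal.one_ne_top hpt).2 h1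
    have hconj : p.toReal.HolderConjugate p.toReal.conjExponent :=
      Real.HolderConjugate.conjExponent h1'
    set r := p.toReal
    set r' := p.toReal.conjExponent
    have hr' : 0 < r' := hconj.symm.pos
    rw [eLpNorm_exponent_top]
    refine essSup_le_of_ae_le _ ?_
    filter_upwards [hrep] with y hy
    have hKm : AEMeasurable (fun x => ‖K (x - y)‖ₑ) μ :=
      (hK.comp (continuous_id.sub continuous_const)).enorm.measurable.aemeasurable
    have hshift : ∫⁻ x, ‖K (x - y)‖ₑ ∂μ ≤ L := by
      rw [lintegral_sub_right_eq_self (fun x => ‖K x‖ₑ) y]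
      exact hL
    -- For `p > 1`: Hölder after splitting `|K| = |K|^{1/r} |K|^{1/r'}`. The first factor of `K` is
    -- bounded through its supremum `κ`, the second through its integral `L`.
    calc ‖h y‖ₑ ≤ ∫⁻ x, ‖h x‖ₑ * ‖K (x - y)‖ₑ ∂μ := hy
      _ = ∫⁻ x, ((fun x => ‖h x‖ₑ * ‖K (x - y)‖ₑ ^ (1 / r)) *
            fun x => ‖K (x - y)‖ₑ ^ (1 / r')) x ∂μ := by
          refine lintegral_congr fun x => ?_
          simp only [Pi.mul_apply]
          rw [mul_assoc, ← ENNReal.rpow_add_of_nonneg _ _ (by positivity) (by positivity)]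
          simp [hconj.inv_add_inv_eq_one]
      _ ≤ (∫⁻ x, (‖h x‖ₑ * ‖K (x - y)‖ₑ ^ (1 / r)) ^ r ∂μ) ^ (1 / r) *
            (∫⁻ x, (‖K (x - y)‖ₑ ^ (1 / r')) ^ r' ∂μ) ^ (1 / r') :=
          ENNReal.lintegral_mul_le_Lp_mul_Lq μ hconj (hhm.mul (hKm.pow_const _))
            (hKm.pow_const _)
      _ ≤ (κ * ∫⁻ x, ‖h x‖ₑ ^ r ∂μ) ^ (1 / r) * L := by
          gcongr
          · rw [← lintegral_const_mul'' _ (hhm.pow_const _)]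
            refine lintegral_mono fun x => ?_
            simp only
            rw [ENNReal.mul_rpow_of_nonneg _ _ hp'.le, ← ENNReal.rpow_mul,
              one_div_mul_cancel hp'.ne', ENNReal.rpow_one, mul_comm]
            gcongr
            exact hκ _
          · simp_rw [← ENNReal.rpow_mul, one_div_mul_cancel hr'.ne', ENNReal.rpow_one]
            calc _ ≤ L ^ (1 / r') := by gcongr
              _ ≤ L ^ (1 : ℝ) := by
                refine ENNReal.rpow_le_rpow_of_exponent_le hL1 ?_
                rw [div_le_one hr']
                exact hconj.symm.lt.le
              _ = L := ENNReal.rpow_one L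
      _ = L * κ ^ (1 / r) * eLpNorm h p μ := by
          rw [ENNReal.mul_rpow_of_nonneg _ _ (by positivity), ← hI]
          ring

/-- Interpolation between `p₀` and `∞`: `|h|^p ≤ (sup |h|)^{p - p₀} |h|^{p₀}`. The bound `1 ≤ A`
only serves to tidy the power of `A`. -/
theorem eLpNorm_le_of_top_le {α : Type*} [MeasurableSpace α] {μ : Measure α} {h : α → ℂ}
    {p₀ p A B : ℝ≥0∞} (hp₀ : 0 < p₀) (hpp : p₀ ≤ p) (hA : 1 ≤ A) (hh : AEStronglyMeasurable h μ)
    (hM : eLpNorm h ⊤ μ ≤ A * B ^ (1 / p₀).toReal * eLpNorm h p₀ μ) :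
    eLpNorm h p μ ≤ A * B ^ ((1 / p₀).toReal - (1 / p).toReal) * eLpNorm h p₀ μ := by
  by_cases hpt : p = ⊤
  · subst hpt
    simpa using hM
  have hpt₀ : p₀ ≠ ⊤ := ne_top_of_le_ne_top hpt hpp
  have h0 : 0 < p₀.toReal := ENNReal.toReal_pos hp₀.ne' hpt₀
  have h1 : p₀.toReal ≤ p.toReal := ENNReal.toReal_mono hpt hpp
  have hp' : 0 < p.toReal := h0.trans_le h1
  have htr₀ : (1 / p₀).toReal = 1 / p₀.toReal := by simp
  have htr : (1 / p).toReal = 1 / p.toReal := by simp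
  have hI₀ := eLpNorm_eq_lintegral_rpow_enorm_toReal (μ := μ) (f := h) hp₀.ne' hpt₀
  have hI := eLpNorm_eq_lintegral_rpow_enorm_toReal (μ := μ) (f := h)
    (hp₀.trans_le hpp).ne' hpt
  have hhm : AEMeasurable (fun x => ‖h x‖ₑ) μ := hh.enorm
  rw [htr₀] at hM
  rw [hI, htr, htr₀]
  set N := eLpNorm h p₀ μ
  have hN : ∫⁻ x, ‖h x‖ₑ ^ p₀.toReal ∂μ = N ^ p₀.toReal := by
    rw [hI₀, ← ENNReal.rpow_mul, one_div_mul_cancel h0.ne', ENNReal.rpow_one]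
  rw [one_div, ENNReal.rpow_inv_le_iff hp']
  calc ∫⁻ x, ‖h x‖ₑ ^ p.toReal ∂μ
      ≤ ∫⁻ x, (A * B ^ (1 / p₀.toReal) * N) ^ (p.toReal - p₀.toReal) * ‖h x‖ₑ ^ p₀.toReal ∂μ := by
        refine lintegral_mono_ae ?_
        filter_upwards [enorm_ae_le_eLpNormEssSup h μ] with x hx
        rw [← eLpNorm_exponent_top] at hx
        calc ‖h x‖ₑ ^ p.toReal
            = ‖h x‖ₑ ^ (p.toReal - p₀.toReal) * ‖h x‖ₑ ^ p₀.toReal := by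
              rw [← ENNReal.rpow_add_of_nonneg _ _ (sub_nonneg.2 h1) h0.le, sub_add_cancel]
          _ ≤ _ := by
              gcongr
              exact hx.trans hM
    _ = (A * B ^ (1 / p₀.toReal)) ^ (p.toReal - p₀.toReal) * N ^ p.toReal := by
        rw [lintegral_const_mul'' _ (hhm.pow_const _), hN,
          ENNReal.mul_rpow_of_nonneg _ _ (sub_nonneg.2 h1), mul_assoc,
          ← ENNReal.rpow_add_of_nonneg _ _ (sub_nonneg.2 h1) h0.le, sub_add_cancel]
    _ = A ^ (p.toReal - p₀.toReal) *
          (B ^ (1 / p₀.toReal - p.toReal⁻¹)) ^ p.toReal * N ^ p.toReal := by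
        rw [ENNReal.mul_rpow_of_nonneg _ _ (sub_nonneg.2 h1), ← ENNReal.rpow_mul,
          ← ENNReal.rpow_mul]
        congr 3
        field_simp
    _ ≤ A ^ p.toReal * (B ^ (1 / p₀.toReal - p.toReal⁻¹)) ^ p.toReal * N ^ p.toReal := by
        gcongr
        exact sub_le_self _ h0.le
    _ = (A * B ^ (1 / p₀.toReal - p.toReal⁻¹) * N) ^ p.toReal := by
        rw [ENNReal.mul_rpow_of_nonneg _ _ hp'.le, ENNReal.mul_rpow_of_nonneg _ _ hp'.le]

/-- By Fubini the convolution moves from the test function to `h`, where it becomes convolution with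
the reflected kernel. -/
theorem ae_eq_integral_mul_of_integral_convolution_eq {d : ℕ}
    {h : EuclideanSpace ℝ (Fin d) → ℂ} (hh : Integrable h volume)
    (Ψ : 𝓢(EuclideanSpace ℝ (Fin d), ℂ))
    (hrep : ∀ u : 𝓢(EuclideanSpace ℝ (Fin d), ℂ),
      ∫ x, SchwartzMap.convolution (ContinuousLinearMap.mul ℂ ℂ) Ψ u x * h x = ∫ x, u x * h x) :
    ∀ᵐ y, h y = ∫ x, h x * Ψ (x - y) := by
  have hΨ : Integrable (fun z => Ψ (-z)) volume := Ψ.integrable.comp_neg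
  have hprod := hh.convolution_integrand (ContinuousLinearMap.mul ℂ ℂ) hΨ
  have hH : Integrable (fun y => ∫ x, h x * Ψ (x - y)) volume := by
    simpa using hprod.integral_prod_left
  refine ae_eq_of_integral_mul_schwartz_eq hh.locallyIntegrable hH.locallyIntegrable fun u => ?_
  rw [← hrep u]
  have hu : Integrable (fun q : EuclideanSpace ℝ (Fin d) × EuclideanSpace ℝ (Fin d) =>
      u q.1 * (h q.2 * Ψ (q.2 - q.1))) (volume.prod volume) := by
    refine (show Integrable (fun q : EuclideanSpace ℝ (Fin d) × EuclideanSpace ℝ (Fin d) =>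
      h q.2 * Ψ (q.2 - q.1)) (volume.prod volume) by simpa using hprod).bdd_mul
      (u.continuous.comp continuous_fst).aestronglyMeasurable
      (Filter.Eventually.of_forall fun q => SchwartzMap.norm_le_seminorm ℝ u q.1)
  calc ∫ x, SchwartzMap.convolution (ContinuousLinearMap.mul ℂ ℂ) Ψ u x * h x
      = ∫ x, ∫ y, u y * (h x * Ψ (x - y)) := by
        refine integral_congr_ae (Filter.Eventually.of_forall fun x => ?_)
        simp only [SchwartzMap.convolution_apply]
        rw [convolution_eq_swap, ← integral_mul_const]
        refine integral_congr_ae (Filter.Eventually.of_forall fun y => ?_)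
        simp only [ContinuousLinearMap.mul_apply']
        ring
    _ = ∫ y, ∫ x, u y * (h x * Ψ (x - y)) := (integral_integral_swap hu).symm
    _ = ∫ y, u y * ∫ x, h x * Ψ (x - y) := by simp_rw [integral_const_mul]

/-- The inverse transform of `c w` is the convolution of those of `c` and `w`. The hypothesis makes
its integrand vanish wherever the symbol does not. -/
theorem fourierBlock_mul_eq_zero {d : ℕ} {m : EuclideanSpace ℝ (Fin d) → ℂ}
    (hm : m.HasTemperateGrowth) (f : 𝓢'(EuclideanSpace ℝ (Fin d), ℂ))
    (c w : 𝓢(EuclideanSpace ℝ (Fin d), ℂ))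
    (h : ∀ ξ ζ, m ((-(2 * Real.pi)) • ξ) ≠ 0 → 𝓕⁻ c ζ ≠ 0 → 𝓕⁻ w (ξ - ζ) = 0) :
    fourierBlock m f (SchwartzMap.pairing (ContinuousLinearMap.mul ℂ ℂ) c w) = 0 := by
  have hm' := hasTemperateGrowth_comp_smul hm (-(2 * Real.pi))
  have hconv : 𝓕⁻ (SchwartzMap.pairing (ContinuousLinearMap.mul ℂ ℂ) c w) =
      SchwartzMap.convolution (ContinuousLinearMap.mul ℂ ℂ) (𝓕⁻ c) (𝓕⁻ w) := by
    simp [SchwartzMap.convolution]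
  rw [fourierBlock, TemperedDistribution.fourierMultiplierCLM_apply_apply, hconv]
  have : SchwartzMap.smulLeftCLM ℂ (fun η => m ((-(2 * Real.pi)) • η))
      (SchwartzMap.convolution (ContinuousLinearMap.mul ℂ ℂ) (𝓕⁻ c) (𝓕⁻ w)) = 0 := by
    ext ξ
    rw [SchwartzMap.smulLeftCLM_apply_apply hm']
    by_cases hξ : m ((-(2 * Real.pi)) • ξ) = 0
    · rw [hξ, zero_smul]
      rfl
    · have : SchwartzMap.convolution (ContinuousLinearMap.mul ℂ ℂ) (𝓕⁻ c) (𝓕⁻ w) ξ = 0 := by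
        rw [SchwartzMap.convolution_apply, MeasureTheory.convolution]
        refine integral_eq_zero_of_ae (Filter.Eventually.of_forall fun ζ => ?_)
        by_cases hζ : 𝓕⁻ c ζ = 0
        · simp [hζ]
        · simp [h ξ ζ hξ hζ]
      simp [this]
  rw [this]
  simp [FourierTransform.fourier_zero]

theorem fourierInv_schwartz_apply {d : ℕ} (u : 𝓢(EuclideanSpace ℝ (Fin d), ℂ))
    (ξ : EuclideanSpace ℝ (Fin d)) : 𝓕⁻ u ξ = 𝓕 u (-ξ) := by
  rw [SchwartzMap.fourierInv_apply_eq]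
  rfl

/-- The function `g` need not be integrable, so it is damped by a Schwartz factor `c`. The spectrum
of `c g` lies in the sum of those of `g` and `c`; if the transform of `Ψ` is `1` there, up to the
reflection caused by `Ψ (x - y)`, convolution with `Ψ` reproduces `c g`. -/
theorem RepresentedBy.integrable_mul_and_reproduced {d : ℕ}
    {m : EuclideanSpace ℝ (Fin d) → ℂ} (hm : m.HasTemperateGrowth)
    {f : 𝓢'(EuclideanSpace ℝ (Fin d), ℂ)} {g : EuclideanSpace ℝ (Fin d) → ℂ}
    (hg : RepresentedBy (fourierBlock m f) g) (c Ψ : 𝓢(EuclideanSpace ℝ (Fin d), ℂ))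
    (h : ∀ ξ ζ, m ((-(2 * Real.pi)) • ξ) ≠ 0 → 𝓕 c ζ ≠ 0 → 𝓕 Ψ (-ξ - ζ) = 1) :
    Integrable (fun x => c x * g x) volume ∧
      ∀ᵐ y, ‖c y * g y‖ₑ ≤ ∫⁻ x, ‖c x * g x‖ₑ * ‖Ψ (x - y)‖ₑ := by
  have hint : Integrable (fun x => c x * g x) volume := (hg.2 c).1
  refine ⟨hint, ?_⟩
  have hae := ae_eq_integral_mul_of_integral_convolution_eq hint Ψ fun u => ?_
  · filter_upwards [hae] with y hy
    calc ‖c y * g y‖ₑ = ‖∫ x, c x * g x * Ψ (x - y)‖ₑ := by rw [← hy]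
      _ ≤ ∫⁻ x, ‖c x * g x * Ψ (x - y)‖ₑ := enorm_integral_le_lintegral_enorm _
      _ = _ := by simp_rw [enorm_mul]
  · have key (v : 𝓢(EuclideanSpace ℝ (Fin d), ℂ)) : ∫ x, v x * (c x * g x) =
        fourierBlock m f (SchwartzMap.pairing (ContinuousLinearMap.mul ℂ ℂ) c v) := by
      rw [(hg.2 _).2]
      refine integral_congr_ae (Filter.Eventually.of_forall fun x => ?_)
      simp only [SchwartzMap.pairing_apply_apply, ContinuousLinearMap.mul_apply']
      ring
    -- Take `w = Ψ * u - u`: its transform carries the factor `𝓕 Ψ - 1`, which vanishes at all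
    -- relevant frequencies.
    rw [key, key, ← sub_eq_zero, ← map_sub, ← map_sub]
    refine fourierBlock_mul_eq_zero hm f c _ fun ξ ζ hξ hζ => ?_
    rw [fourierInv_schwartz_apply] at hζ ⊢
    have h1 := h ξ (-ζ) hξ hζ
    rw [← fourierCLM_apply (R := ℂ), map_sub, fourierCLM_apply, fourierCLM_apply, SchwartzMap.fourier_convolution]
    have h2 : -ξ - -ζ = ζ - ξ := by abel
    rw [h2] at h1
    simp [h1]

/-- A nonzero Schwartz function whose Fourier transform is supported in a given ball. -/
theorem exists_schwartz_fourier_support {d : ℕ} (x₀ : EuclideanSpace ℝ (Fin d)) {r : ℝ}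
    (hr : 0 < r) : ∃ F : 𝓢(EuclideanSpace ℝ (Fin d), ℂ), F 0 ≠ 0 ∧
      ∀ ξ, 𝓕 F ξ ≠ 0 → ‖ξ - x₀‖ < r := by
  let b : ContDiffBump x₀ := ⟨r / 2, r, half_pos hr, half_lt_self hr⟩
  obtain ⟨u, hu⟩ := exists_schwartz_eq_ofReal b.hasCompactSupport b.contDiff
  refine ⟨𝓕⁻ u, ?_, fun ξ hξ => ?_⟩
  · have : 𝓕⁻ u 0 = ((∫ x, b x : ℝ) : ℂ) := by
      rw [SchwartzMap.fourierInv_coe, Real.fourierInv_eq]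
      simp only [inner_zero_right, AddChar.map_zero_eq_one, one_smul, hu]
      exact integral_ofReal
    rw [this]
    exact_mod_cast b.integral_pos.ne'
  · rw [FourierTransform.fourier_fourierInv_eq, hu] at hξ
    have : ξ ∈ Function.support b := fun h => hξ (by rw [h]; simp)
    rwa [b.support_eq, Metric.mem_ball, dist_eq_norm] at this

theorem eLpNorm_schwartz_ne_zero {d : ℕ} {F : 𝓢(EuclideanSpace ℝ (Fin d), ℂ)} (hF : F 0 ≠ 0)
    {p : ℝ≥0∞} (hp : 0 < p) : eLpNorm F p volume ≠ 0 := by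
  intro h
  rw [eLpNorm_eq_zero_iff F.continuous.aestronglyMeasurable hp.ne',
    F.continuous.ae_eq_iff_eq volume continuous_zero] at h
  exact hF (by rw [h]; rfl)

theorem EuclideanSpace.norm_le_of_forall_abs_le_one {d : ℕ} {x : EuclideanSpace ℝ (Fin d)}
    (h : ∀ i, |x i| ≤ 1) : ‖x‖ ≤ d := by
  calc ‖x‖ = ‖∑ i, EuclideanSpace.single i (x i)‖ := by
        congr 1
        ext j
        simp [Finset.sum_apply, Pi.single_apply]
    _ ≤ ∑ i, ‖EuclideanSpace.single i (x i)‖ := norm_sum_le _ _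
    _ ≤ ∑ _i : Fin d, (1 : ℝ) := by
        gcongr with i
        simpa using h i
    _ = d := by simp

/-- A Schwartz reproducing kernel for functions with spectrum in the unit cube. -/
theorem exists_schwartz_fourier_eq_one (d : ℕ) :
    ∃ Ψ : 𝓢(EuclideanSpace ℝ (Fin d), ℂ), ∀ ξ, (∀ i, |ξ i| ≤ 1) → 𝓕 Ψ ξ = 1 := by
  let b : ContDiffBump (0 : EuclideanSpace ℝ (Fin d)) :=
    ⟨d + 1, d + 2, by positivity, by linarith⟩
  obtain ⟨u, hu⟩ := exists_schwartz_eq_ofReal b.hasCompactSupport b.contDiff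
  refine ⟨𝓕⁻ u, fun ξ hξ => ?_⟩
  rw [FourierTransform.fourier_fourierInv_eq, hu, b.one_of_mem_closedBall, Complex.ofReal_one]
  rw [mem_closedBall_zero_iff]
  exact (EuclideanSpace.norm_le_of_forall_abs_le_one hξ).trans (by simp [b])

theorem dyadicScale_const_apply {d : ℕ} (n : ℤ) (x : EuclideanSpace ℝ (Fin d)) :
    dyadicScale (fun _ => n) x = (2 : ℝ) ^ n • x := by
  ext i
  simp

theorem enorm_schwartz_le_seminorm {d : ℕ} (F : 𝓢(EuclideanSpace ℝ (Fin d), ℂ))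
    (x : EuclideanSpace ℝ (Fin d)) : ‖F x‖ₑ ≤ ENNReal.ofReal (SchwartzMap.seminorm ℝ 0 0 F) := by
  rw [← ofReal_norm]
  exact ENNReal.ofReal_le_ofReal (SchwartzMap.norm_le_seminorm ℝ F x)

theorem two_zpow_eq_ofReal (n : ℤ) : ‖((2 : ℝ) ^ n : ℝ)‖ₑ = (2 : ℝ≥0∞) ^ (n : ℝ) := by
  rw [Real.enorm_eq_ofReal (by positivity), ← Real.rpow_intCast,
    ← ENNReal.ofReal_rpow_of_pos two_pos]
  simp

/-- Nikol'skii's inequality for a band-limited function given by the Fourier multiplier `m`. -/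
theorem exists_nikolskii_const (d : ℕ) {p₀ p : ℝ≥0∞} (hp₀ : 0 < p₀) (hpp : p₀ ≤ p) :
    ∃ C : ℝ≥0∞, C ≠ ⊤ ∧ ∀ (k : Fin d → ℕ) (m : EuclideanSpace ℝ (Fin d) → ℂ),
      m.HasTemperateGrowth →
      (∀ ξ, m ((-(2 * Real.pi)) • ξ) ≠ 0 → ∀ i, |ξ i| ≤ 2 ^ (k i : ℤ) / 2) →
      ∀ (f : 𝓢'(EuclideanSpace ℝ (Fin d), ℂ)) (g : EuclideanSpace ℝ (Fin d) → ℂ),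
        RepresentedBy (fourierBlock m f) g →
        eLpNorm g p volume ≤ C * (2 : ℝ≥0∞) ^ (((∑ i, k i : ℕ) : ℝ) *
          ((1 / p₀).toReal - (1 / p).toReal)) * eLpNorm g p₀ volume := by
  obtain ⟨F, hF0, hF⟩ := exists_schwartz_fourier_support (0 : EuclideanSpace ℝ (Fin d))
    (r := 1 / 2) (by norm_num)
  obtain ⟨Ψ, hΨ⟩ := exists_schwartz_fourier_eq_one d
  set a : ℝ≥0∞ := ENNReal.ofReal (SchwartzMap.seminorm ℝ 0 0 F) with ha
  set b : ℝ≥0∞ := max 1 (ENNReal.ofReal (SchwartzMap.seminorm ℝ 0 0 Ψ)) with hb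
  set L : ℝ≥0∞ := max 1 (∫⁻ x, ‖Ψ x‖ₑ) with hL
  set A : ℝ≥0∞ := L * b ^ (1 / p₀).toReal with hA
  have hb_top : b ≠ ⊤ := by simp [hb]
  have hL_top : L ≠ ⊤ := by
    simp only [hL, ne_eq, max_eq_top, ENNReal.one_ne_top, false_or]
    exact Ψ.integrable.hasFiniteIntegral.ne
  have hA_top : A ≠ ⊤ :=
    ENNReal.mul_ne_top hL_top (ENNReal.rpow_ne_top_of_nonneg ENNReal.toReal_nonneg hb_top)
  have hA_one : 1 ≤ A :=
    one_le_mul (le_max_left _ _) ((ENNReal.one_rpow _).symm.le.trans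
      (ENNReal.rpow_le_rpow (le_max_left _ _) ENNReal.toReal_nonneg))
  have hF0' : ‖F 0‖ₑ ≠ 0 := by simpa using hF0
  refine ⟨‖F 0‖ₑ⁻¹ * (A * a), ENNReal.mul_ne_top (ENNReal.inv_ne_top.2 hF0')
    (ENNReal.mul_ne_top hA_top ENNReal.ofReal_ne_top), fun k m hm hsupp f g hg => ?_⟩
  set S : ℤ := ∑ i, (k i : ℤ) with hS
  set D : ℝ≥0∞ := (2 : ℝ≥0∞) ^ (S : ℝ) with hD
  have hSk : (S : ℝ) = ((∑ i, k i : ℕ) : ℝ) := by simp [hS]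
  have hD_top : D ≠ ⊤ := ENNReal.rpow_ne_top_of_ne_zero two_ne_zero ENNReal.ofNat_ne_top
  have hD_zero : D ≠ 0 := (ENNReal.rpow_pos two_pos ENNReal.ofNat_ne_top).ne'
  -- The dilation normalized in `L₁`: its integral norm does not depend on `k`, its supremum grows
  -- like `2^{|k|}`, and its transform is `1` on the box `|ξ i| ≤ 2^{k i}`.
  set Ψk : 𝓢(EuclideanSpace ℝ (Fin d), ℂ) :=
    ((2 : ℝ) ^ S) • schwartzScale (fun i => (k i : ℤ)) Ψ with hΨk
  have hΨk_apply (x) : ‖Ψk x‖ₑ = D * ‖Ψ (dyadicScale (fun i => (k i : ℤ)) x)‖ₑ := by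
    rw [hΨk, smul_apply, enorm_smul, two_zpow_eq_ofReal, schwartzScale_apply]
  have hΨk_sup (x) : ‖Ψk x‖ₑ ≤ b * D := by
    rw [hΨk_apply, mul_comm]
    gcongr
    exact (enorm_schwartz_le_seminorm Ψ _).trans (le_max_right _ _)
  have hΨk_int : ∫⁻ x, ‖Ψk x‖ₑ ≤ L := by
    simp_rw [hΨk_apply]
    rw [lintegral_const_mul' _ _ hD_top,
      lintegral_comp_dyadicScale _ (g := fun x => ‖Ψ x‖ₑ) Ψ.continuous.enorm.measurable,
      ← mul_assoc, ENNReal.rpow_neg, ENNReal.mul_inv_cancel hD_zero hD_top, one_mul]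
    exact le_max_right _ _
  have hΨk_fourier (ξ : EuclideanSpace ℝ (Fin d)) (hξ : ∀ i, |ξ i| ≤ 2 ^ (k i : ℤ)) :
      𝓕 Ψk ξ = 1 := by
    have h1 : 𝓕 Ψk = ((2 : ℝ) ^ S) • 𝓕 (schwartzScale (fun i => (k i : ℤ)) Ψ) := by
      rw [hΨk, FourierTransform.fourier_smul]
    rw [h1, smul_apply, fourier_schwartzScale, smul_smul, ← zpow_add₀ two_ne_zero,
      add_neg_cancel, zpow_zero, one_smul]
    refine hΨ _ fun i => ?_
    rw [dyadicScale_apply, abs_mul, Pi.neg_apply, zpow_neg,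
      abs_of_pos (by positivity : (0 : ℝ) < ((2 : ℝ) ^ (k i : ℤ))⁻¹)]
    exact inv_mul_le_one_of_le₀ (hξ i) (by positivity)
  -- Damping factors `F (2^{-n} x)`: bounded by the same `a` for all `n`, with spectrum in `|ζ i| ≤
  -- 1/2`, and tending pointwise to the nonzero constant `F 0`. The spectrum of `c n * g` stays in
  -- the box since `2^{k i} / 2 + 1/2 ≤ 2^{k i}`.
  let c (n : ℕ) : 𝓢(EuclideanSpace ℝ (Fin d), ℂ) := schwartzScale (fun _ => -(n : ℤ)) F
  have hc_fourier (n : ℕ) (ζ) (hζ : 𝓕 (c n) ζ ≠ 0) (i : Fin d) : |ζ i| ≤ 1 / 2 := by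
    rw [fourier_schwartzScale] at hζ
    have h1 := hF _ (right_ne_zero_of_smul hζ)
    have h2 : -(fun _ : Fin d => -(n : ℤ)) = fun _ => (n : ℤ) := by ext; simp
    rw [h2, dyadicScale_const_apply, sub_zero, norm_smul, zpow_natCast, Real.norm_of_nonneg
      (by positivity)] at h1
    calc |ζ i| ≤ ‖ζ‖ := by simpa using PiLp.norm_apply_le ζ i
      _ ≤ 2 ^ n * ‖ζ‖ := le_mul_of_one_le_left (norm_nonneg _) (one_le_pow₀ one_le_two)
      _ ≤ 1 / 2 := h1.le
  have hstep (n : ℕ) : eLpNorm (fun x => c n x * g x) p volume ≤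
      A * a * (2 : ℝ≥0∞) ^ (((∑ i, k i : ℕ) : ℝ) * ((1 / p₀).toReal - (1 / p).toReal)) *
        eLpNorm g p₀ volume := by
    obtain ⟨hint, hrep⟩ := hg.integrable_mul_and_reproduced hm (c n) Ψk fun ξ ζ hξ hζ => by
      refine hΨk_fourier _ fun i => ?_
      have h1 := hsupp ξ hξ i
      have h2 := hc_fourier n ζ hζ i
      have h3 : (1 : ℝ) ≤ 2 ^ (k i : ℤ) := by
        rw [zpow_natCast]
        exact one_le_pow₀ one_le_two
      calc |(-ξ - ζ) i| = |-(ξ i) - ζ i| := rfl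
        _ ≤ |-(ξ i)| + |ζ i| := abs_sub _ _
        _ ≤ 2 ^ (k i : ℤ) := by rw [abs_neg]; linarith
    have htop := eLpNorm_top_le_of_le_lintegral_kernel hp₀ Ψk.continuous hΨk_sup
      (ENNReal.mul_ne_top hb_top hD_top) hΨk_int (le_max_left _ _) hint hrep
    rw [ENNReal.mul_rpow_of_nonneg _ _ ENNReal.toReal_nonneg, ← mul_assoc] at htop
    have hfin := eLpNorm_le_of_top_le hp₀ hpp hA_one hint.aestronglyMeasurable htop
    have hcg : eLpNorm (fun x => c n x * g x) p₀ volume ≤ a * eLpNorm g p₀ volume := by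
      refine (eLpNorm_le_nnreal_smul_eLpNorm_of_ae_le_mul
        (c := (SchwartzMap.seminorm ℝ 0 0 F).toNNReal)
        (Filter.Eventually.of_forall fun x => ?_) p₀)
      rw [nnnorm_mul]
      gcongr
      rw [← NNReal.coe_le_coe, Real.coe_toNNReal _ (by positivity)]
      exact SchwartzMap.norm_le_seminorm ℝ F _
    rw [← hSk, ENNReal.rpow_mul]
    calc _ ≤ _ := hfin
      _ ≤ A * D ^ ((1 / p₀).toReal - (1 / p).toReal) * (a * eLpNorm g p₀ volume) := by gcongr
      _ = _ := by ring
  have hlim (x) : Filter.Tendsto (fun n => c n x * g x) Filter.atTop (nhds (F 0 * g x)) := by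
    refine Filter.Tendsto.mul_const _ ((F.continuous.tendsto 0).comp ?_)
    have h0 : Filter.Tendsto (fun n : ℕ => ((2 : ℝ)⁻¹ ^ n) • x) Filter.atTop (nhds 0) := by
      simpa using (tendsto_pow_atTop_nhds_zero_of_lt_one (by norm_num : (0 : ℝ) ≤ 2⁻¹)
        (by norm_num)).smul_const x
    refine h0.congr fun n => Eq.trans ?_ (dyadicScale_const_apply (-(n : ℤ)) x).symm
    rw [zpow_neg, zpow_natCast, inv_pow]
  -- The bound `hstep` is uniform in `n`, so Fatou's lemma removes the damping.
  have hfatou := Lp.eLpNorm_lim_le_liminf_eLpNorm (p := p) (μ := volume)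
    (f := fun n x => c n x * g x)
    (fun n => (c n).continuous.aestronglyMeasurable.mul hg.1) (fun x => F 0 * g x)
    (Filter.Eventually.of_forall hlim)
  have hle := hfatou.trans (Filter.liminf_le_of_le (by isBoundedDefault) fun y hy => by
    obtain ⟨n, hn⟩ := hy.exists
    exact hn.trans (hstep n))
  have hsm : eLpNorm (fun x => F 0 * g x) p volume = ‖F 0‖ₑ * eLpNorm g p volume :=
    eLpNorm_const_smul (F 0) g p volume
  rw [hsm, mul_comm, ← ENNReal.le_div_iff_mul_le (Or.inl hF0') (Or.inl enorm_ne_top)] at hle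
  refine hle.trans (le_of_eq ?_)
  rw [ENNReal.div_eq_inv_mul]
  ring

/-! ### Sufficient conditions for embeddings of mixed spaces -/

theorem LineGenerator.eq_zero (φ : LineGenerator) {s : ℝ} (hs : 3 / 2 < |s|) : φ.toFun s = 0 :=
  image_eq_zero_of_notMem_tsupport fun h =>
    hs.not_ge (abs_le.2 (φ.tsupport_subset h))

theorem LineGenerator.abs_le_of_dyadic_ne_zero (φ : LineGenerator) {j : ℕ} {s : ℝ}
    (h : φ.dyadic j s ≠ 0) : |s| ≤ 3 / 2 * 2 ^ (j : ℤ) := by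
  by_contra! hs
  refine h ?_
  by_cases hj : j = 0
  · rw [LineGenerator.dyadic, if_pos hj, φ.eq_zero]
    simpa [hj] using hs
  · have h1 : 3 / 2 < |(2 : ℝ) ^ (-(j : ℤ)) * s| := by
      rw [abs_mul, abs_of_pos (by positivity : (0 : ℝ) < 2 ^ (-(j : ℤ))), zpow_neg,
        lt_inv_mul_iff₀ (by positivity)]
      linarith
    have h2 : 3 / 2 < |(2 : ℝ) ^ (-(j : ℤ) + 1) * s| := by
      rw [zpow_add_one₀ two_ne_zero, mul_assoc, mul_left_comm, abs_mul, abs_two]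
      linarith
    rw [LineGenerator.dyadic, if_neg hj, φ.eq_zero h1, φ.eq_zero h2, sub_zero]

theorem LineGenerator.abs_le_of_tensor_ne_zero {d : ℕ} (φ : LineGenerator) {k : Fin d → ℕ}
    {ξ : EuclideanSpace ℝ (Fin d)} (h : φ.tensor k ((-(2 * Real.pi)) • ξ) ≠ 0) (i : Fin d) :
    |ξ i| ≤ 2 ^ (k i : ℤ) / 2 := by
  have h1 := φ.abs_le_of_dyadic_ne_zero (Finset.prod_ne_zero_iff.1 h i (Finset.mem_univ i))
  have h2 : |((-(2 * Real.pi)) • ξ) i| = 2 * Real.pi * |ξ i| := by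
    simp [abs_mul, abs_of_pos Real.pi_pos]
  rw [h2] at h1
  have h3 := mul_le_mul_of_nonneg_right Real.pi_gt_three.le (abs_nonneg (ξ i))
  have h4 : (0 : ℝ) < 2 ^ (k i : ℤ) := by positivity
  linarith

theorem exists_lpNormDist_tensor_le {d : ℕ} (φ : LineGenerator) {p₀ p : ℝ≥0∞} (hp₀ : 0 < p₀)
    (hpp : p₀ ≤ p) : ∃ C : ℝ≥0∞, C ≠ ⊤ ∧
      ∀ (k : Fin d → ℕ) (f : 𝓢'(EuclideanSpace ℝ (Fin d), ℂ)),
        lpNormDist p (fourierBlock (φ.tensor k) f) ≤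
          C * ((2 : ℝ≥0∞) ^ (((∑ i, k i : ℕ) : ℝ) * ((1 / p₀).toReal - (1 / p).toReal)) *
            lpNormDist p₀ (fourierBlock (φ.tensor k) f)) := by
  obtain ⟨C, hC, h⟩ := exists_nikolskii_const d hp₀ hpp
  -- If the block is not a function, the right-hand side must be `∞`. A positive constant rules out
  -- `0 * ∞ = 0`.
  refine ⟨max C 1, by simp [hC], fun k f => ?_⟩
  by_cases hex : ∃ g, RepresentedBy (fourierBlock (φ.tensor k) f) g
  · obtain ⟨g, hg⟩ := hex
    rw [hg.lpNormDist_eq, hg.lpNormDist_eq, ← mul_assoc]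
    refine (h k _ (φ.tensor_hasTemperateGrowth k)
      (fun ξ hξ i => φ.abs_le_of_tensor_ne_zero hξ i) f g hg).trans ?_
    gcongr
    exact le_max_left _ _
  · have htop : lpNormDist p₀ (fourierBlock (φ.tensor k) f) = ⊤ :=
      iInf₂_eq_top.2 fun g hg => absurd ⟨g, hg⟩ hex
    have hC0 : max C 1 ≠ 0 := (zero_lt_one.trans_le (le_max_right C 1)).ne'
    have h2 : (2 : ℝ≥0∞) ^ (((∑ i, k i : ℕ) : ℝ) * ((1 / p₀).toReal - (1 / p).toReal)) ≠ 0 :=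
      (ENNReal.rpow_pos two_pos ENNReal.ofNat_ne_top).ne'
    rw [htop, ENNReal.mul_top h2, ENNReal.mul_top hC0]
    exact le_top

/-- Sufficient conditions for the embedding of Besov spaces of dominating mixed smoothness. -/
theorem exists_mixedBesovNorm_le {d : ℕ} (φ : LineGenerator) {t₀ t : ℝ} {p₀ p q₀ q : ℝ≥0∞}
    (hp₀ : 0 < p₀) (hpp : p₀ ≤ p) (hq₀ : 0 < q₀) (hq : 0 < q)
    (hδ : t - (1 / p).toReal ≤ t₀ - (1 / p₀).toReal)
    (hqq : t - (1 / p).toReal = t₀ - (1 / p₀).toReal → q₀ ≤ q) :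
    ∃ C : ℝ≥0∞, C ≠ ⊤ ∧ ∀ f : 𝓢'(EuclideanSpace ℝ (Fin d), ℂ),
      mixedBesovNorm φ t p q f ≤ C * mixedBesovNorm φ t₀ p₀ q₀ f := by
  obtain ⟨C, hC, h⟩ := exists_lpNormDist_tensor_le (d := d) φ hp₀ hpp
  set δ : ℝ := (t₀ - (1 / p₀).toReal) - (t - (1 / p).toReal) with hδdef
  have hterm (f : 𝓢'(EuclideanSpace ℝ (Fin d), ℂ)) (k : Fin d → ℕ) :
      (2 : ℝ≥0∞) ^ (((∑ i, k i : ℕ) : ℝ) * t) * lpNormDist p (fourierBlock (φ.tensor k) f) ≤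
        C * ((2 : ℝ≥0∞) ^ (((∑ i, k i : ℕ) : ℝ) * -δ) * ((2 : ℝ≥0∞) ^ (((∑ i, k i : ℕ) : ℝ) * t₀) *
          lpNormDist p₀ (fourierBlock (φ.tensor k) f))) := by
    refine (mul_le_mul_right (h k f) _).trans (le_of_eq ?_)
    rw [mul_left_comm, ← mul_assoc (2 ^ _) (2 ^ _), ← mul_assoc (2 ^ _) (2 ^ _),
      ← ENNReal.rpow_add _ _ two_ne_zero ENNReal.ofNat_ne_top,
      ← ENNReal.rpow_add _ _ two_ne_zero ENNReal.ofNat_ne_top, hδdef]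
    ring_nf
  -- With `δ = 0` nothing is gained from the weights and `q₀ ≤ q` is needed. With `δ > 0` each block
  -- is bounded by the full quasi-norm and `2^{-δ|k|}` is summable to any power.
  rcases hδ.eq_or_lt with h0 | h0
  · refine ⟨C, hC, fun f => ?_⟩
    have hδ0 : δ = 0 := by rw [hδdef, h0, sub_self]
    calc mixedBesovNorm φ t p q f ≤ _ := lqNorm_mono q (hterm f)
      _ = C * mixedBesovNorm φ t₀ p₀ q f := by
        rw [lqNorm_const_mul hq]
        simp only [hδ0, neg_zero, mul_zero, ENNReal.rpow_zero, one_mul]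
        rfl
      _ ≤ C * mixedBesovNorm φ t₀ p₀ q₀ f := by
        gcongr
        exact lqNorm_anti hq₀ (hqq h0) _
  · have hδ0 : 0 < δ := sub_pos.2 h0
    have hsum := lqNorm_two_rpow_neg_lt_top (d := d) hq hδ0
    refine ⟨C * lqNorm q (fun k : Fin d → ℕ => (2 : ℝ≥0∞) ^ (((∑ i, k i : ℕ) : ℝ) * -δ)),
      ENNReal.mul_ne_top hC hsum.ne, fun f => ?_⟩
    calc mixedBesovNorm φ t p q f ≤ lqNorm q (fun k : Fin d → ℕ =>
          C * (mixedBesovNorm φ t₀ p₀ q₀ f * (2 : ℝ≥0∞) ^ (((∑ i, k i : ℕ) : ℝ) * -δ))) := by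
          refine lqNorm_mono q fun k => (hterm f k).trans ?_
          rw [mul_comm (mixedBesovNorm φ t₀ p₀ q₀ f)]
          gcongr
          exact le_lqNorm hq₀ (fun k : Fin d → ℕ => (2 : ℝ≥0∞) ^ (((∑ i, k i : ℕ) : ℝ) * t₀) *
            lpNormDist p₀ (fourierBlock (φ.tensor k) f)) k
      _ = _ := by
        rw [lqNorm_const_mul hq, lqNorm_const_mul hq]
        ring

/-! ### Spectrally localized test functions -/

/-- For `3/4 * 2^j < r ≤ 2^j` the cut-off at scale `2^n` is `1` if `n ≥ j` and `0` if `n < j`, so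
only the difference with index `j` survives. Here `v c` stands for the generator at the point scaled
by `c`, which treats the line and the isotropic case at once. -/
theorem dyadic_difference_eq_ite {v : ℝ → ℂ} {r : ℝ} (h1 : ∀ c, 0 < c → c * r ≤ 1 → v c = 1)
    (h0 : ∀ c, 0 < c → 3 / 2 < c * r → v c = 0) {j : ℕ} (hr : r ≤ 2 ^ j)
    (hr' : j ≠ 0 → 3 / 4 * 2 ^ j < r) (i : ℕ) :
    (if i = 0 then v 1 else v ((2 : ℝ) ^ (-(i : ℤ))) - v ((2 : ℝ) ^ (-(i : ℤ) + 1))) =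
      if i = j then 1 else 0 := by
  have two_pow_pos (n : ℕ) : (0 : ℝ) < 2 ^ n := by positivity
  have hs (n : ℕ) : (2 : ℝ) ^ (-((n + 1 : ℕ) : ℤ) + 1) = (2 : ℝ) ^ (-(n : ℤ)) := by
    push_cast; ring_nf
  have hle (n : ℕ) (hn : j ≤ n) : v ((2 : ℝ) ^ (-(n : ℤ))) = 1 := by
    refine h1 _ (by positivity) ?_
    rw [zpow_neg, zpow_natCast]
    exact inv_mul_le_one_of_le₀ (hr.trans (pow_le_pow_right₀ one_le_two hn)) (two_pow_pos n).le
  have hlt (n : ℕ) (hn : n < j) : v ((2 : ℝ) ^ (-(n : ℤ))) = 0 := by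
    refine h0 _ (by positivity) ?_
    rw [zpow_neg, zpow_natCast, lt_inv_mul_iff₀ (two_pow_pos n)]
    have h2 : (2 : ℝ) ^ (n + 1) ≤ 2 ^ j := pow_le_pow_right₀ one_le_two hn
    have h3 := hr' (by omega)
    rw [pow_succ] at h2
    linarith
  rcases i with _ | n
  · have hv : v 1 = v ((2 : ℝ) ^ (-((0 : ℕ) : ℤ))) := by simp
    rw [if_pos rfl, hv]
    rcases Nat.eq_zero_or_pos j with hj | hj
    · rw [hle 0 hj.le, if_pos hj.symm]
    · rw [hlt 0 hj, if_neg hj.ne]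
  · rw [if_neg n.succ_ne_zero, hs]
    rcases lt_trichotomy (n + 1) j with h | h | h
    · rw [hlt _ h, hlt n (by omega), if_neg h.ne, sub_zero]
    · rw [hle _ h.ge, hlt n (by omega), if_pos h, sub_zero]
    · rw [hle _ h.le, hle n (by omega), if_neg h.ne', sub_self]

theorem LineGenerator.dyadic_eq_ite (φ : LineGenerator) {s : ℝ} {j : ℕ} (hs : |s| ≤ 2 ^ j)
    (hs' : j ≠ 0 → 3 / 4 * 2 ^ j < |s|) (i : ℕ) : φ.dyadic i s = if i = j then 1 else 0 := by
  rw [← dyadic_difference_eq_ite (v := fun c => φ.toFun (c * s)) (fun c hc h => ?_)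
    (fun c hc h => ?_) hs hs' i]
  · simp [LineGenerator.dyadic]
  · exact φ.eq_one _ (abs_le.1 (by rwa [abs_mul, abs_of_pos hc]))
  · exact φ.eq_zero (by rwa [abs_mul, abs_of_pos hc])

theorem IsoGenerator.dyadic_eq_ite {d : ℕ} (ψ : IsoGenerator d) {x : EuclideanSpace ℝ (Fin d)}
    {j : ℕ} (hx : ‖x‖ ≤ 2 ^ j) (hx' : j ≠ 0 → 3 / 4 * 2 ^ j < ‖x‖) (i : ℕ) :
    ψ.dyadic i x = if i = j then 1 else 0 := by
  rw [← dyadic_difference_eq_ite (v := fun c => (ψ.toFun (c • x) : ℂ)) (fun c hc h => ?_)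
    (fun c hc h => ?_) hx hx' i]
  · simp [IsoGenerator.dyadic]
  · rw [ψ.eq_one _ (by rwa [norm_smul, Real.norm_of_nonneg hc.le]), Complex.ofReal_one]
  · rw [ψ.eq_zero _ (by rw [norm_smul, Real.norm_of_nonneg hc.le]; exact h.le),
      Complex.ofReal_zero]

theorem LineGenerator.tensor_eq_ite {d : ℕ} (φ : LineGenerator) {x : EuclideanSpace ℝ (Fin d)}
    {κ : Fin d → ℕ} (hx : ∀ i, |x i| ≤ 2 ^ κ i) (hx' : ∀ i, κ i ≠ 0 → 3 / 4 * 2 ^ κ i < |x i|)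
    (k : Fin d → ℕ) : φ.tensor k x = if k = κ then 1 else 0 := by
  simp only [LineGenerator.tensor, fun i => φ.dyadic_eq_ite (hx i) (hx' i) (k i)]
  rw [Finset.prod_ite_zero]
  simp [funext_iff]

/-- The frequencies of `G` lie where only the isotropic block `j` and the mixed block
`(0, …, j, …, 0)`, with `j` at position `i₀`, do not vanish. -/
def DyadicLocalized {d : ℕ} (i₀ : Fin d) (j : ℕ) (G : 𝓢(EuclideanSpace ℝ (Fin d), ℂ)) : Prop :=
  ∀ η, 𝓕 G η ≠ 0 → ∀ x, x = (-(2 * Real.pi)) • η →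
    (‖x‖ ≤ 2 ^ j ∧ (j ≠ 0 → 3 / 4 * 2 ^ j < ‖x‖)) ∧
      (∀ i, |x i| ≤ 2 ^ (Pi.single i₀ j : Fin d → ℕ) i) ∧
      ∀ i, (Pi.single i₀ j : Fin d → ℕ) i ≠ 0 →
        3 / 4 * 2 ^ (Pi.single i₀ j : Fin d → ℕ) i < |x i|

theorem DyadicLocalized.smul {d : ℕ} {i₀ : Fin d} {j : ℕ}
    {G : 𝓢(EuclideanSpace ℝ (Fin d), ℂ)} (hG : DyadicLocalized i₀ j G) (c : ℂ) :
    DyadicLocalized i₀ j (c • G) := fun η hη => by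
  rw [FourierTransform.fourier_smul, smul_apply] at hη
  exact hG η (right_ne_zero_of_smul hη)

theorem DyadicLocalized.fourierBlock_dyadic {d : ℕ} {i₀ : Fin d} {j : ℕ}
    {G : 𝓢(EuclideanSpace ℝ (Fin d), ℂ)} (hG : DyadicLocalized i₀ j G) (ψ : IsoGenerator d)
    (i : ℕ) : fourierBlock (ψ.dyadic i) (G : 𝓢'(EuclideanSpace ℝ (Fin d), ℂ)) =
      if i = j then (G : 𝓢'(EuclideanSpace ℝ (Fin d), ℂ)) else 0 := by
  rw [fourierBlock_schwartz (ψ.dyadic_hasTemperateGrowth i) (if i = j then 1 else 0) G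
    fun η hη => ψ.dyadic_eq_ite (hG η hη _ rfl).1.1 (hG η hη _ rfl).1.2 i]
  split_ifs <;> simp

theorem DyadicLocalized.fourierBlock_tensor {d : ℕ} {i₀ : Fin d} {j : ℕ}
    {G : 𝓢(EuclideanSpace ℝ (Fin d), ℂ)} (hG : DyadicLocalized i₀ j G) (φ : LineGenerator)
    (k : Fin d → ℕ) : fourierBlock (φ.tensor k) (G : 𝓢'(EuclideanSpace ℝ (Fin d), ℂ)) =
      if k = Pi.single i₀ j then (G : 𝓢'(EuclideanSpace ℝ (Fin d), ℂ)) else 0 := by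
  rw [fourierBlock_schwartz (φ.tensor_hasTemperateGrowth k)
    (if k = Pi.single i₀ j then 1 else 0) G
    fun η hη => φ.tensor_eq_ite (hG η hη _ rfl).2.1 (hG η hη _ rfl).2.2 k]
  split_ifs <;> simp

theorem lpNormDist_zero {d : ℕ} (p : ℝ≥0∞) :
    lpNormDist p (0 : 𝓢'(EuclideanSpace ℝ (Fin d), ℂ)) = 0 := by
  have h := lpNormDist_schwartz p (0 : 𝓢(EuclideanSpace ℝ (Fin d), ℂ))
  rw [map_zero] at h
  rw [h]
  exact eLpNorm_zero

theorem isoBesovNorm_sum {d : ℕ} {i₀ : Fin d} (ψ : IsoGenerator d) (t : ℝ) {p q : ℝ≥0∞}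
    (hq : 0 < q) {s : Finset ℕ} (hs : s.Nonempty) {G : ℕ → 𝓢(EuclideanSpace ℝ (Fin d), ℂ)}
    (hG : ∀ j ∈ s, DyadicLocalized i₀ j (G j)) {X : ℝ≥0∞}
    (hX : ∀ j ∈ s, (2 : ℝ≥0∞) ^ ((j : ℝ) * t) * eLpNorm (G j) p volume = X) :
    isoBesovNorm ψ t p q (∑ j ∈ s, (G j : 𝓢'(EuclideanSpace ℝ (Fin d), ℂ))) =
      (s.card : ℝ≥0∞) ^ (1 / q).toReal * X := by
  rw [← lqNorm_indicator hq hs X, isoBesovNorm]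
  congr 1
  ext i
  have h1 : fourierBlock (ψ.dyadic i) (∑ j ∈ s, (G j : 𝓢'(EuclideanSpace ℝ (Fin d), ℂ))) =
      if i ∈ s then (G i : 𝓢'(EuclideanSpace ℝ (Fin d), ℂ)) else 0 := by
    rw [fourierBlock, map_sum, ← Finset.sum_ite_eq s i fun j =>
      (G j : 𝓢'(EuclideanSpace ℝ (Fin d), ℂ))]
    exact Finset.sum_congr rfl fun j hj => (hG j hj).fourierBlock_dyadic ψ i
  rw [h1]
  split_ifs with hi
  · rw [lpNormDist_schwartz, hX i hi]
  · rw [lpNormDist_zero, mul_zero]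

/-- The multi-index `(0, …, j, …, 0)` has `|k| = j` and determines `j`, so the result has the same
shape as for the isotropic quasi-norm. -/
theorem mixedBesovNorm_sum {d : ℕ} {i₀ : Fin d} (φ : LineGenerator) (t : ℝ) {p q : ℝ≥0∞}
    (hq : 0 < q) {s : Finset ℕ} (hs : s.Nonempty) {G : ℕ → 𝓢(EuclideanSpace ℝ (Fin d), ℂ)}
    (hG : ∀ j ∈ s, DyadicLocalized i₀ j (G j)) {Y : ℝ≥0∞}
    (hY : ∀ j ∈ s, (2 : ℝ≥0∞) ^ ((j : ℝ) * t) * eLpNorm (G j) p volume = Y) :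
    mixedBesovNorm φ t p q (∑ j ∈ s, (G j : 𝓢'(EuclideanSpace ℝ (Fin d), ℂ))) =
      (s.card : ℝ≥0∞) ^ (1 / q).toReal * Y := by
  have hinj : Function.Injective fun j : ℕ => (Pi.single i₀ j : Fin d → ℕ) :=
    fun a b h => Pi.single_injective (M := fun _ : Fin d => ℕ) i₀ h
  rw [← Finset.card_image_of_injective s hinj, ← lqNorm_indicator hq (hs.image _) Y,
    mixedBesovNorm]
  congr 1
  ext k
  have h1 : fourierBlock (φ.tensor k) (∑ j ∈ s, (G j : 𝓢'(EuclideanSpace ℝ (Fin d), ℂ))) =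
      ∑ j ∈ s, if k = Pi.single i₀ j then (G j : 𝓢'(EuclideanSpace ℝ (Fin d), ℂ)) else 0 := by
    rw [fourierBlock, map_sum]
    exact Finset.sum_congr rfl fun j hj => (hG j hj).fourierBlock_tensor φ k
  rw [h1]
  split_ifs with hk
  · obtain ⟨j, hj, rfl⟩ := Finset.mem_image.1 hk
    have h2 : (∑ j' ∈ s, if (Pi.single i₀ j : Fin d → ℕ) = Pi.single i₀ j' then
        (G j' : 𝓢'(EuclideanSpace ℝ (Fin d), ℂ)) else 0) = G j := by
      simp only [hinj.eq_iff, Finset.sum_ite_eq, if_pos hj]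
    rw [h2, lpNormDist_schwartz, Finset.sum_pi_single', if_pos (Finset.mem_univ i₀), hY j hj]
  · rw [Finset.sum_eq_zero fun j hj => if_neg fun h => hk (Finset.mem_image.2 ⟨j, hj, h.symm⟩),
      lpNormDist_zero, mul_zero]

theorem eLpNorm_smul_schwartzScale {d : ℕ} (n : Fin d → ℤ) (c : ℂ)
    (F : 𝓢(EuclideanSpace ℝ (Fin d), ℂ)) (p : ℝ≥0∞) :
    eLpNorm (c • schwartzScale n F) p volume =
      ‖c‖ₑ * ((2 : ℝ≥0∞) ^ (-((∑ i, n i : ℤ) : ℝ) * (1 / p).toReal) * eLpNorm F p volume) := by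
  rw [← eLpNorm_comp_dyadicScale n p F.continuous.aestronglyMeasurable]
  exact eLpNorm_const_smul c (fun x => F (dyadicScale n x)) p volume

/-- Otherwise the powers of `2 ^ (x - y) > 1` would stay below the finite `D / A`. -/
theorem le_of_forall_two_rpow_mul_le {A D : ℝ≥0∞} (hA : A ≠ 0) (hD : D ≠ ⊤) {x y : ℝ}
    (h : ∀ n : ℕ, n ≠ 0 → (2 : ℝ≥0∞) ^ ((n : ℝ) * x) * A ≤ D * (2 : ℝ≥0∞) ^ ((n : ℝ) * y)) :
    x ≤ y := by
  by_contra! hxy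
  have h2 (z : ℝ) : (2 : ℝ≥0∞) ^ z ≠ ⊤ :=
    ENNReal.rpow_ne_top_of_ne_zero two_ne_zero ENNReal.ofNat_ne_top
  have hb : (1 : ℝ≥0∞) < (2 : ℝ≥0∞) ^ (x - y) :=
    ENNReal.one_lt_rpow ENNReal.one_lt_two (sub_pos.2 hxy)
  have hDA : D / A ≠ ⊤ := ENNReal.div_ne_top hD hA
  have hle (n : ℕ) (hn : n ≠ 0) : ((2 : ℝ≥0∞) ^ (x - y)) ^ n ≤ D / A := by
    have hAt : A ≠ ⊤ := by
      intro hAt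
      have h1 := h n hn
      rw [hAt, ENNReal.mul_top (ENNReal.rpow_pos two_pos ENNReal.ofNat_ne_top).ne',
        top_le_iff] at h1
      exact ENNReal.mul_ne_top hD (h2 _) h1
    rw [ENNReal.le_div_iff_mul_le (Or.inl hA) (Or.inl hAt), ← ENNReal.rpow_natCast,
      ← ENNReal.rpow_mul]
    calc (2 : ℝ≥0∞) ^ ((x - y) * n) * A
        = (2 : ℝ≥0∞) ^ ((n : ℝ) * x) * A * (2 : ℝ≥0∞) ^ (-((n : ℝ) * y)) := by
          rw [mul_right_comm, ← ENNReal.rpow_add _ _ two_ne_zero ENNReal.ofNat_ne_top]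
          ring_nf
      _ ≤ D * (2 : ℝ≥0∞) ^ ((n : ℝ) * y) * (2 : ℝ≥0∞) ^ (-((n : ℝ) * y)) := by
          gcongr ?_ * _
          exact h n hn
      _ = D := by
          rw [mul_assoc, ← ENNReal.rpow_add _ _ two_ne_zero ENNReal.ofNat_ne_top]
          simp
  obtain ⟨n, hn⟩ := ((ENNReal.tendsto_pow_atTop_nhds_top_iff.2 hb).eventually
    (lt_mem_nhds hDA.lt_top)).and (Filter.eventually_ne_atTop 0) |>.exists
  exact absurd hn.1 (hle n hn.2).not_gt

theorem le_of_one_div_toReal_le {a b : ℝ≥0∞} (ha : 0 < a) (hb : 0 < b)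
    (h : (1 / b).toReal ≤ (1 / a).toReal) : a ≤ b := by
  rw [one_div, one_div, ENNReal.toReal_le_toReal (ENNReal.inv_ne_top.2 hb.ne')
    (ENNReal.inv_ne_top.2 ha.ne'), ENNReal.inv_le_inv] at h
  exact h

theorem dyadicLocalized_zero {d : ℕ} (i₀ : Fin d) (n : ℕ) {F : 𝓢(EuclideanSpace ℝ (Fin d), ℂ)}
    (hF : ∀ ξ, 𝓕 F ξ ≠ 0 → ‖ξ - 0‖ < 1 / 8) :
    DyadicLocalized i₀ 0 (schwartzScale (fun _ => -(n : ℤ)) F) := by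
  rintro η hη x rfl
  rw [fourier_schwartzScale] at hη
  have h1 := hF _ (right_ne_zero_of_smul hη)
  have h2 : -(fun _ : Fin d => -(n : ℤ)) = fun _ => (n : ℤ) := by ext; simp
  rw [h2, dyadicScale_const_apply, sub_zero, norm_smul, zpow_natCast, Real.norm_of_nonneg
    (by positivity)] at h1
  have h3 : ‖η‖ ≤ 1 / 8 :=
    (le_mul_of_one_le_left (norm_nonneg η) (one_le_pow₀ one_le_two)).trans h1.le
  have h4 : ‖(-(2 * Real.pi)) • η‖ ≤ 1 := by
    rw [norm_smul, norm_neg, Real.norm_of_nonneg (by positivity)]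
    nlinarith [Real.pi_le_four, Real.pi_pos, norm_nonneg η]
  refine ⟨⟨by simpa using h4, fun h => absurd rfl h⟩, fun i => ?_, fun i hi => ?_⟩
  · have h5 := PiLp.norm_apply_le ((-(2 * Real.pi)) • η) i
    rw [Real.norm_eq_abs] at h5
    simpa only [Pi.single_zero, Pi.zero_apply, pow_zero] using h5.trans h4
  · simp at hi

/-- The interval `7/8 ± 1/10` lies inside `(3/4, 1)`, and the factors `-(2π)⁻¹` translate
frequencies to the normalization of `𝓕`. Only coordinate `i₀` is stretched, so the others remain in
block `0`. -/
theorem dyadicLocalized_single {d : ℕ} (i₀ : Fin d) {j : ℕ}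
    {F : 𝓢(EuclideanSpace ℝ (Fin d), ℂ)}
    (hF : ∀ ξ, 𝓕 F ξ ≠ 0 → ‖ξ - (-(2 * Real.pi))⁻¹ • EuclideanSpace.single i₀ (7 / 8 : ℝ)‖ <
      (2 * Real.pi)⁻¹ * (1 / 10)) :
    DyadicLocalized i₀ j (schwartzScale (Pi.single i₀ (j : ℤ)) F) := by
  rintro η hη x rfl
  rw [fourier_schwartzScale] at hη
  have h1 := hF _ (right_ne_zero_of_smul hη)
  set y : EuclideanSpace ℝ (Fin d) :=
    (-(2 * Real.pi)) • dyadicScale (-Pi.single i₀ (j : ℤ)) η with hy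
  have hx : (-(2 * Real.pi)) • η = dyadicScale (Pi.single i₀ (j : ℤ)) y := by
    rw [hy, map_smul, dyadicScale_apply_neg]
  have hπ : (0 : ℝ) < 2 * Real.pi := by positivity
  have hy1 : ‖y - EuclideanSpace.single i₀ (7 / 8 : ℝ)‖ < 1 / 10 := by
    have : y - EuclideanSpace.single i₀ (7 / 8 : ℝ) = (-(2 * Real.pi)) •
        (dyadicScale (-Pi.single i₀ (j : ℤ)) η -
          (-(2 * Real.pi))⁻¹ • EuclideanSpace.single i₀ (7 / 8 : ℝ)) := by
      rw [smul_sub, smul_smul, mul_inv_cancel₀ (neg_ne_zero.2 hπ.ne'), one_smul]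
    rw [this, norm_smul, norm_neg, Real.norm_of_nonneg hπ.le]
    rwa [lt_inv_mul_iff₀ hπ] at h1
  have hcoord (i : Fin d) : |y i - (EuclideanSpace.single i₀ (7 / 8 : ℝ) :
      EuclideanSpace ℝ (Fin d)) i| < 1 / 10 :=
    lt_of_le_of_lt (PiLp.norm_apply_le (y - EuclideanSpace.single i₀ (7 / 8 : ℝ)) i) hy1
  have hy0 : 3 / 4 < |y i₀| ∧ |y i₀| ≤ 1 := by
    have h := hcoord i₀
    simp only [PiLp.single_apply, if_true] at h
    rw [abs_lt] at h
    rw [abs_of_pos (by linarith)]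
    constructor <;> linarith
  have hyi (i : Fin d) (hi : i ≠ i₀) : |y i| ≤ 1 := by
    have h := hcoord i
    simp only [PiLp.single_apply, if_neg hi, sub_zero] at h
    linarith
  have hynorm : ‖y‖ ≤ 1 := by
    have h := norm_le_norm_add_norm_sub' y (EuclideanSpace.single i₀ (7 / 8 : ℝ))
    rw [PiLp.norm_single, Real.norm_of_nonneg (by norm_num)] at h
    linarith
  have hxi₀ : |((-(2 * Real.pi)) • η) i₀| = 2 ^ j * |y i₀| := by
    rw [hx, dyadicScale_apply, Pi.single_eq_same, abs_mul, zpow_natCast,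
      abs_of_pos (by positivity : (0 : ℝ) < 2 ^ j)]
  have hxi (i : Fin d) (hi : i ≠ i₀) : |((-(2 * Real.pi)) • η) i| = |y i| := by
    rw [hx, dyadicScale_apply, Pi.single_eq_of_ne hi, zpow_zero, one_mul]
  have hpow : (1 : ℝ) ≤ 2 ^ j := one_le_pow₀ one_le_two
  have hlow : 3 / 4 * 2 ^ j < |((-(2 * Real.pi)) • η) i₀| := by
    rw [hxi₀]
    nlinarith [hy0.1]
  refine ⟨⟨?_, fun _ => hlow.trans_le ?_⟩, fun i => ?_, fun i hi => ?_⟩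
  · calc ‖(-(2 * Real.pi)) • η‖ ≤ ‖(2 ^ j : ℝ) • y‖ := by
          rw [EuclideanSpace.norm_eq, EuclideanSpace.norm_eq]
          refine Real.sqrt_le_sqrt (Finset.sum_le_sum fun i _ => ?_)
          refine pow_le_pow_left₀ (norm_nonneg _) ?_ 2
          rw [Real.norm_eq_abs, Real.norm_eq_abs,
            show ((2 ^ j : ℝ) • y) i = 2 ^ j * y i from rfl, abs_mul,
            abs_of_pos (by positivity : (0 : ℝ) < 2 ^ j)]
          by_cases hi : i = i₀
          · rw [hi, hxi₀]
          · rw [hxi i hi]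
            exact le_mul_of_one_le_left (abs_nonneg _) hpow
      _ ≤ 2 ^ j := by
          rw [norm_smul, Real.norm_of_nonneg (by positivity)]
          exact mul_le_of_le_one_right (by positivity) hynorm
  · simpa only [Real.norm_eq_abs] using PiLp.norm_apply_le ((-(2 * Real.pi)) • η) i₀
  · by_cases h : i = i₀
    · subst h
      rw [hxi₀, Pi.single_eq_same]
      exact mul_le_of_le_one_right (by positivity) hy0.2
    · rw [hxi i h, Pi.single_eq_of_ne h, pow_zero]
      exact hyi i h
  · by_cases h : i = i₀
    · subst h
      rwa [Pi.single_eq_same]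
    · exact absurd (Pi.single_eq_of_ne (M := fun _ : Fin d => ℕ) h j) hi

/-! ### Necessary conditions for the embedding into the isotropic space -/

section Necessity

variable {d : ℕ} {φ : LineGenerator} {ψ : IsoGenerator d} {t₀ t : ℝ} {p₀ p q₀ q C : ℝ≥0∞}

theorem card_rpow_mul_le_of_isoBesovNorm_le (hq₀ : 0 < q₀) (hq : 0 < q)
    (h : ∀ f, isoBesovNorm ψ t p q f ≤ C * mixedBesovNorm φ t₀ p₀ q₀ f) {i₀ : Fin d}
    {s : Finset ℕ} (hs : s.Nonempty) {G : ℕ → 𝓢(EuclideanSpace ℝ (Fin d), ℂ)}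
    (hG : ∀ j ∈ s, DyadicLocalized i₀ j (G j)) {X Y : ℝ≥0∞}
    (hX : ∀ j ∈ s, (2 : ℝ≥0∞) ^ ((j : ℝ) * t) * eLpNorm (G j) p volume = X)
    (hY : ∀ j ∈ s, (2 : ℝ≥0∞) ^ ((j : ℝ) * t₀) * eLpNorm (G j) p₀ volume = Y) :
    (s.card : ℝ≥0∞) ^ (1 / q).toReal * X ≤ C * ((s.card : ℝ≥0∞) ^ (1 / q₀).toReal * Y) := by
  rw [← isoBesovNorm_sum ψ t hq hs hG hX, ← mixedBesovNorm_sum φ t₀ hq₀ hs hG hY]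
  exact h _

theorem integrability_le_of_isoBesovNorm_le (i₀ : Fin d) (hp₀ : 0 < p₀) (hp : 0 < p)
    (hq₀ : 0 < q₀) (hq : 0 < q) (hC : C ≠ ⊤)
    (h : ∀ f, isoBesovNorm ψ t p q f ≤ C * mixedBesovNorm φ t₀ p₀ q₀ f) : p₀ ≤ p := by
  obtain ⟨F, hF0, hF⟩ := exists_schwartz_fourier_support (0 : EuclideanSpace ℝ (Fin d))
    (r := 1 / 8) (by norm_num)
  have hd : (0 : ℝ) < d := by exact_mod_cast i₀.pos
  -- The functions `F (2^{-n} x)` lie in block `0` of both decompositions and have norms `2^{nd/p}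
  -- ‖F‖_p`, so `d/p ≤ d/p₀` as `n` grows.
  refine le_of_one_div_toReal_le hp₀ hp (le_of_mul_le_mul_left ?_ hd)
  refine le_of_forall_two_rpow_mul_le (eLpNorm_schwartz_ne_zero hF0 hp)
    (ENNReal.mul_ne_top hC (F.memLp p₀ volume).eLpNorm_ne_top) fun n _ => ?_
  have key := card_rpow_mul_le_of_isoBesovNorm_le hq₀ hq h (Finset.singleton_nonempty 0)
    (G := fun _ => (1 : ℂ) • schwartzScale (fun _ => -(n : ℤ)) F) (fun j hj => by
      rw [Finset.mem_singleton.1 hj]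
      exact (dyadicLocalized_zero i₀ n hF).smul 1)
    (fun j hj => by rw [Finset.mem_singleton.1 hj]) (fun j hj => by rw [Finset.mem_singleton.1 hj])
  simp only [eLpNorm_smul_schwartzScale] at key
  simp only [Finset.card_singleton, Nat.cast_one, ENNReal.one_rpow, one_mul, Nat.cast_zero,
    zero_mul, ENNReal.rpow_zero, enorm_one, Finset.sum_const, Finset.card_univ, Fintype.card_fin,
    smul_neg, nsmul_eq_mul, Int.cast_neg, Int.cast_mul, Int.cast_natCast, neg_neg] at key
  calc _ = (2 : ℝ≥0∞) ^ ((d : ℝ) * n * (1 / p).toReal) * eLpNorm F p volume := by ring_nf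
    _ ≤ _ := key
    _ = _ := by ring_nf

theorem exists_localized_family (i₀ : Fin d) : ∃ F : 𝓢(EuclideanSpace ℝ (Fin d), ℂ), F 0 ≠ 0 ∧
    ∀ j : ℕ, DyadicLocalized i₀ j (schwartzScale (Pi.single i₀ (j : ℤ)) F) := by
  obtain ⟨F, hF0, hF⟩ := exists_schwartz_fourier_support
    ((-(2 * Real.pi))⁻¹ • EuclideanSpace.single i₀ (7 / 8 : ℝ))
    (r := (2 * Real.pi)⁻¹ * (1 / 10)) (by positivity)
  exact ⟨F, hF0, fun j => dyadicLocalized_single i₀ hF⟩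

/-- Stretching a single variable changes the norm by `2^{-j/p}` rather than `2^{-jd/p}`; hence the
differential dimension here is `t - 1/p`. -/
theorem two_rpow_mul_eLpNorm_single (i₀ : Fin d) (F : 𝓢(EuclideanSpace ℝ (Fin d), ℂ))
    (j : ℕ) (c : ℤ → ℂ) (e t : ℝ) (hc : ‖c j‖ₑ = (2 : ℝ≥0∞) ^ ((j : ℝ) * e)) (p : ℝ≥0∞) :
    (2 : ℝ≥0∞) ^ ((j : ℝ) * t) *
        eLpNorm (c j • schwartzScale (Pi.single i₀ (j : ℤ)) F) p volume =
      (2 : ℝ≥0∞) ^ ((j : ℝ) * (t - (1 / p).toReal + e)) * eLpNorm F p volume := by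
  rw [eLpNorm_smul_schwartzScale, hc, Finset.sum_pi_single', if_pos (Finset.mem_univ i₀),
    ← mul_assoc, ← mul_assoc, ← ENNReal.rpow_add _ _ two_ne_zero ENNReal.ofNat_ne_top,
    ← ENNReal.rpow_add _ _ two_ne_zero ENNReal.ofNat_ne_top]
  congr 2
  push_cast
  ring

theorem smoothness_le_of_isoBesovNorm_le (i₀ : Fin d) (hp : 0 < p)
    (hq₀ : 0 < q₀) (hq : 0 < q) (hC : C ≠ ⊤)
    (h : ∀ f, isoBesovNorm ψ t p q f ≤ C * mixedBesovNorm φ t₀ p₀ q₀ f) :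
    t - (1 / p).toReal ≤ t₀ - (1 / p₀).toReal := by
  obtain ⟨F, hF0, hF⟩ := exists_localized_family i₀
  refine le_of_forall_two_rpow_mul_le (eLpNorm_schwartz_ne_zero hF0 hp)
    (ENNReal.mul_ne_top hC (F.memLp p₀ volume).eLpNorm_ne_top) fun n _ => ?_
  have hnorm (r : ℝ) (ρ : ℝ≥0∞) := two_rpow_mul_eLpNorm_single i₀ F n (fun _ => 1) 0 r
    (by simp) ρ
  have key := card_rpow_mul_le_of_isoBesovNorm_le hq₀ hq h (Finset.singleton_nonempty n)
    (G := fun j => (1 : ℂ) • schwartzScale (Pi.single i₀ (j : ℤ)) F)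
    (fun j _ => (hF j).smul 1)
    (fun j hj => by rw [Finset.mem_singleton.1 hj])
    (fun j hj => by rw [Finset.mem_singleton.1 hj])
  rw [hnorm t p, hnorm t₀ p₀] at key
  simp only [Finset.card_singleton, Nat.cast_one, ENNReal.one_rpow, one_mul, add_zero] at key
  calc _ ≤ _ := key
    _ = _ := by ring

theorem summability_le_of_isoBesovNorm_le (i₀ : Fin d) (hp : 0 < p)
    (hq₀ : 0 < q₀) (hq : 0 < q) (hC : C ≠ ⊤)
    (h : ∀ f, isoBesovNorm ψ t p q f ≤ C * mixedBesovNorm φ t₀ p₀ q₀ f)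
    (heq : t - (1 / p).toReal = t₀ - (1 / p₀).toReal) : q₀ ≤ q := by
  obtain ⟨F, hF0, hF⟩ := exists_localized_family i₀
  refine le_of_one_div_toReal_le hq₀ hq ?_
  refine le_of_forall_two_rpow_mul_le (eLpNorm_schwartz_ne_zero hF0 hp)
    (ENNReal.mul_ne_top hC (F.memLp p₀ volume).eLpNorm_ne_top) fun n _ => ?_
  -- The coefficients `2^{je}` make every weighted block norm independent of `j`, for both parameter
  -- sets simultaneously because of `heq`.
  let e : ℝ := -(t - (1 / p).toReal)
  let c (j : ℤ) : ℂ := (((2 : ℝ) ^ ((j : ℝ) * e) : ℝ) : ℂ)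
  have hc (j : ℕ) : ‖c j‖ₑ = (2 : ℝ≥0∞) ^ ((j : ℝ) * e) := by
    rw [← ofReal_norm, Complex.norm_real, Real.norm_of_nonneg (by positivity),
      ← ENNReal.ofReal_rpow_of_pos two_pos]
    simp
  have hnorm (j : ℕ) (r : ℝ) (ρ : ℝ≥0∞) (hr : r - (1 / ρ).toReal = t - (1 / p).toReal) :
      (2 : ℝ≥0∞) ^ ((j : ℝ) * r) *
        eLpNorm (c j • schwartzScale (Pi.single i₀ (j : ℤ)) F) ρ volume = eLpNorm F ρ volume := by
    rw [two_rpow_mul_eLpNorm_single i₀ F j c e r (hc j) ρ, hr]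
    simp [e]
  -- With `2^n` equal pieces the inequality reads `2^{n/q} ‖F‖_p ≤ C 2^{n/q₀} ‖F‖_{p₀}`.
  have key := card_rpow_mul_le_of_isoBesovNorm_le hq₀ hq h
    (s := Finset.range (2 ^ n)) (Finset.nonempty_range_iff.2 (by positivity))
    (G := fun j => c j • schwartzScale (Pi.single i₀ (j : ℤ)) F)
    (fun j _ => (hF j).smul (c j)) (fun j _ => hnorm j t p rfl) (fun j _ => hnorm j t₀ p₀ heq.symm)
  rw [Finset.card_range, Nat.cast_pow, Nat.cast_ofNat, ← ENNReal.rpow_natCast,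
    ← ENNReal.rpow_mul, ← ENNReal.rpow_mul] at key
  calc _ ≤ _ := key
    _ = _ := by ring

end Necessity

/-! ### From conditions on the parameters to embeddings -/

theorem ContEmbeds.exists_forall_le {d : ℕ}
    {NX NY : 𝓢'(EuclideanSpace ℝ (Fin d), ℂ) → ℝ≥0∞} (h : ContEmbeds NX NY) :
    ∃ C : ℝ≥0∞, C ≠ ⊤ ∧ ∀ f, NY f ≤ C * NX f := by
  obtain ⟨-, C, hC⟩ := h
  -- A positive constant extends the estimate to all distributions: outside the source space the
  -- right-hand side is `∞`.
  refine ⟨max C 1, by simp, fun f => ?_⟩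
  by_cases hf : NX f < ⊤
  · exact (hC f hf).trans (mul_le_mul_left (le_max_left _ _) _)
  · rw [not_lt_top_iff.1 hf, ENNReal.mul_top (zero_lt_one.trans_le (le_max_right _ _)).ne']
    exact le_top

theorem contEmbeds_of_forall_le {d : ℕ} {NX NY : 𝓢'(EuclideanSpace ℝ (Fin d), ℂ) → ℝ≥0∞}
    {C : ℝ≥0∞} (hC : C ≠ ⊤) (h : ∀ f, NY f ≤ C * NX f) : ContEmbeds NX NY := by
  lift C to ℝ≥0 using hC
  exact ⟨fun f hf => (h f).trans_lt (ENNReal.mul_lt_top ENNReal.coe_lt_top hf),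
    C, fun f _ => h f⟩

/-- Every Besov space of dominating mixed smoothness that embeds into `B^t_{p,q}` also embeds
into `S^t_{p,q}B`. -/
theorem contEmbeds_mixedBesovNorm {d : ℕ} (hd : 1 ≤ d) (φ : LineGenerator) (ψ : IsoGenerator d)
    {t₀ t : ℝ} {p₀ p q₀ q : ℝ≥0∞} (hp₀ : 0 < p₀) (hp : 0 < p) (hq₀ : 0 < q₀) (hq : 0 < q)
    (h : ContEmbeds (mixedBesovNorm φ t₀ p₀ q₀) (isoBesovNorm ψ t p q)) :
    ContEmbeds (mixedBesovNorm (d := d) φ t₀ p₀ q₀) (mixedBesovNorm φ t p q) := by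
  obtain ⟨C, hC, hle⟩ := h.exists_forall_le
  let i₀ : Fin d := ⟨0, hd⟩
  obtain ⟨C', hC', hle'⟩ := exists_mixedBesovNorm_le (d := d) φ hp₀
    (integrability_le_of_isoBesovNorm_le i₀ hp₀ hp hq₀ hq hC hle) hq₀ hq
    (smoothness_le_of_isoBesovNorm_le i₀ hp hq₀ hq hC hle)
    (summability_le_of_isoBesovNorm_le i₀ hp hq₀ hq hC hle)
  exact contEmbeds_of_forall_le hC' hle'

end

theorem theorem3p4 (d : ℕ) (hd : 1 ≤ d) (φ : LineGenerator) (ψ : IsoGenerator d)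
    (t : ℝ) (p q : ℝ≥0∞) (hp : 0 < p) (hq : 0 < q) :
    (∀ N ∈ mixedSpacesEmbeddingInto φ ψ t p q, ContEmbeds N (mixedBesovNorm φ t p q)) ∧
    (ContEmbeds (mixedBesovNorm (d := d) φ t p q) (isoBesovNorm ψ t p q) →
      mixedBesovNorm φ t p q ∈ mixedSpacesEmbeddingInto φ ψ t p q ∧
      ∀ N ∈ mixedSpacesEmbeddingInto φ ψ t p q,
        ContEmbeds N (mixedBesovNorm φ t p q)) := by
  have main : ∀ N ∈ mixedSpacesEmbeddingInto φ ψ t p q,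
      ContEmbeds N (mixedBesovNorm φ t p q) := by
    rintro N ⟨t₀, p₀, q₀, hp₀, hq₀, rfl, h⟩
    exact contEmbeds_mixedBesovNorm hd φ ψ hp₀ hp hq₀ hq h
  exact ⟨main, fun h => ⟨⟨t, p, q, hp, hq, rfl, h⟩, main⟩⟩
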